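/- A (finite) Markov decision process (MDP) $M=(S,E,S_1,S_2,\delta)$ consists of a finite set of states $S$, a relation $E\subseteq S\times S$ such that every state has a successor, a partition $S=S_1\uplus S_2$ into states of player 1 and stochastic states, and for each $s\in S_2$ a rational probability distribution $\delta(s)$ on $S$ whose support is exactly the set of successors of $s$. A strategy of player 1 maps every finite path ending in a state $s\in S_1$ to a rational probability distribution supported on successors of $s$; it is memoryless if its choice depends only on the last state of the path. A strategy $\lambda$ and an initial state $s$ induce a probability measure $\mathbb{P}^{\lambda}_{M,s}$ on plays (infinite paths of $(S,E)$); a play is consistent with $\lambda$ if each of its transitions from a state of $S_1$ has positive probability under $\lambda$. Let $\inf(\pi)$ be the set of states visited infinitely often by $\pi$. For a priority function $p\colon S\to\mathbb{N}$, the parity objective, also written $p$, is the set of plays $\pi$ such that $\max_{s\in\inf(\pi)}p(s)$ is even. An end-component (EC) of $M$ is a non-empty set $C\subseteq S$ such that every $s\in C\cap S_2$ has all its successors in $C$, every $s\in C\cap S_1$ has a successor in $C$, and any two states of $C$ are connected by a path that stays in $C$; $M_{\downharpoonright C}$ denotes the sub-MDP of $M$ with set of states $C$. For $D\subseteq S$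 let $$D^{\max}_{\mathrm{even}}(p)=\{s\in D\mid p(s)\text{ is even and } p(s')<p(s)\text{ for all } s'\in D\text{ with } p(s')\text{ odd}\}.$$ Lemma. Let $p_1,p_2$ be two priority functions on an MDP $M$ and let $C$ be an EC of $M$. Consider the condition $(2_U)$: for every $s\in C$ there is a strategy $\lambda$ in $M_{\downharpoonright C}$ with $\mathbb{P}^{\lambda}_{M_{\downharpoonright C},s}[p_1]=1$ and $\mathbb{P}^{\lambda}_{M_{\downharpoonright C},s}[p_2]=1$ (equivalently, $\mathbb{P}^{\lambda}_{M_{\downharpoonright C},s}[p_1\cap p_2]=1$). 1. Given $M$, $C$, $p_1$, $p_2$, it can be decided in polynomial time whether $(2_U)$ holds. 2. If $(2_U)$ holds, then there exist a single randomized memoryless strategy $\lambda_{2,C}$ in $M_{\downharpoonright C}$ that is a witness of $(2_U)$ from all $s\in C$, and an EC $D\subseteq C$ of $M$, such that $D^{\max}_{\mathrm{even}}(p_1)\neq\emptyset$, $D^{\max}_{\mathrm{even}}(p_2)\neq\emptyset$, and for all $s\in C$, $$\mathbb{P}^{\lambda_{2,C}}_{M_{\downharpoonright C},s}\big[\{\pi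 \text{ consistent with } \lambda_{2,C}\mid \inf(\pi)=D\}\big]=1.$$ 3. Furthermore, for the same $\lambda_{2,C}$ and $D$: for all $s\in C$ and all $\varepsilon>0$ there is $n\in\mathbb{N}$ such that $$\mathbb{P}^{\lambda_{2,C}}_{M_{\downharpoonright C},s}\big[\{\pi \text{ consistent with } \lambda_{2,C}\mid \exists\, i,\ 0\le i\le n,\ \pi(i)\in D^{\max}_{\mathrm{even}}(p_1)\}\big]\ge 1-\varepsilon.$$ -/

import Mathlib

open MeasureTheory ProbabilityTheory

/-! ## Finite Markov decision processes -/

/-- Rational probability distributions on a finite set. -/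
structure RatDist (A : Type*) [Fintype A] where
  prob : A → ℚ
  nonneg : ∀ a, 0 ≤ prob a
  sum_eq_one : ∑ a, prob a = 1

/-- The probability measure associated with a rational distribution. -/
noncomputable def RatDist.toMeasure {A : Type*} [Fintype A] [MeasurableSpace A]
    (d : RatDist A) : Measure A :=
  ∑ a, ENNReal.ofReal (d.prob a : ℝ) • Measure.dirac a

instance RatDist.isProbabilityMeasure {A : Type*} [Fintype A] [MeasurableSpace A]
    (d : RatDist A) : IsProbabilityMeasure d.toMeasure := by
  constructor
  have h : (∑ a, ENNReal.ofReal (d.prob a : ℝ)) = 1 := by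
    rw [← ENNReal.ofReal_sum_of_nonneg (fun a _ => by exact_mod_cast d.nonneg a)]
    rw [← Rat.cast_sum, d.sum_eq_one]
    simp
  simpa [RatDist.toMeasure] using h

/-- A finite MDP with set of states `S`: a non-blocking directed graph `(S, E)`, the set `S1` of
states of player 1 (all other states are stochastic), and for every stochastic state a rational
distribution whose support is exactly the set of its successors. -/
structure MDP (S : Type*) [Fintype S] where
  E : S → S → Prop
  nonblocking : ∀ s, ∃ t, E s t
  S1 : Set S
  δ : {s : S // s ∉ S1} → RatDist S
  supp_δ : ∀ s t, 0 < (δ s).prob t ↔ E s t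

/-- Sequences `s₀ s₁ … sₙ` of `n + 1` states. -/
abbrev Prefix (S : Type*) (n : ℕ) : Type _ := (i : Finset.Iic n) → S

/-- The last state of `s₀ s₁ … sₙ`. -/
def Prefix.last {S : Type*} {n : ℕ} (ρ : Prefix S n) : S := ρ ⟨n, Finset.mem_Iic.2 le_rfl⟩

/-- The prefix `π(0, n)` of an infinite sequence. -/
def playPrefix {S : Type*} (π : ℕ → S) (n : ℕ) : Prefix S n := fun i => π i

/-- The set of states that are seen infinitely often. -/
def infStates {S : Type*} (π : ℕ → S) : Set S := {s | ∀ i, ∃ j, i ≤ j ∧ π j = s}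

namespace MDP

variable {S : Type*} [Fintype S] (M : MDP S)

/-- Plays: infinite paths of the graph. -/
def Plays : Set (ℕ → S) := {π | ∀ i, M.E (π i) (π (i + 1))}

/-- A (randomized, history-dependent) strategy of player 1. It is convenient to define it on all
finite sequences ending in a state of player 1; its values on sequences that are not paths
are irrelevant. -/
structure Strategy where
  act : ∀ (n : ℕ) (ρ : Prefix S n), ρ.last ∈ M.S1 → RatDist S
  supp_act : ∀ n ρ h t, 0 < (act n ρ h).prob t → M.E ρ.last t

variable {M}

/-- A strategy is memoryless if its choices depend only on the current state. -/
def Strategy.Memoryless (lam : M.Strategy) : Prop :=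
  ∀ m n (ρ : Prefix S m) (ρ' : Prefix S n) (h : ρ.last ∈ M.S1) (h' : ρ'.last ∈ M.S1),
    ρ.last = ρ'.last → lam.act m ρ h = lam.act n ρ' h'

/-- The plays that are consistent with a strategy. -/
def Out (lam : M.Strategy) : Set (ℕ → S) :=
  {π | π ∈ M.Plays ∧
    ∀ n (h : (playPrefix π n).last ∈ M.S1), 0 < (lam.act n (playPrefix π n) h).prob (π (n + 1))}

open Classical in
/-- The distribution of the next state after a prefix. -/
noncomputable def next (lam : M.Strategy) (n : ℕ) (ρ : Prefix S n) : RatDist S :=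
  if h : ρ.last ∈ M.S1 then lam.act n ρ h else M.δ ⟨ρ.last, h⟩

/-- The transition kernels from prefixes to next states. -/
noncomputable def stepKernel [MeasurableSpace S] [MeasurableSingletonClass S]
    (lam : M.Strategy) (n : ℕ) : Kernel (Prefix S n) S :=
  Kernel.ofFunOfCountable fun ρ => (next lam n ρ).toMeasure

instance [MeasurableSpace S] [MeasurableSingletonClass S] (lam : M.Strategy) (n : ℕ) :
    IsMarkovKernel (stepKernel lam n) :=
  ⟨fun ρ => inferInstanceAs (IsProbabilityMeasure (next lam n ρ).toMeasure)⟩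

/-- The probability measure on infinite sequences of states that is induced by the
strategy `lam` and the initial state `s`. -/
noncomputable def Pr [MeasurableSpace S] [MeasurableSingletonClass S]
    (lam : M.Strategy) (s : S) : Measure (ℕ → S) :=
  Kernel.traj (X := fun _ => S) (stepKernel lam) 0 (fun _ => s)

variable (M)

/-- The parity objective: the maximal priority seen infinitely often is even. -/
def Parity (p : S → ℕ) : Set (ℕ → S) :=
  {π | π ∈ M.Plays ∧ ∃ s ∈ infStates π, Even (p s) ∧ ∀ t ∈ infStates π, p t ≤ p s}

/-- End-components: non-empty strongly connected sets of states that are traps for player 2. -/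
structure IsEC (C : Finset S) : Prop where
  nonempty : C.Nonempty
  closed : ∀ s ∈ C, s ∉ M.S1 → ∀ t, M.E s t → t ∈ C
  stay : ∀ s ∈ C, s ∈ M.S1 → ∃ t ∈ C, M.E s t
  connected : ∀ s ∈ C, ∀ t ∈ C,
    Relation.ReflTransGen (fun a b => a ∈ C ∧ b ∈ C ∧ M.E a b) s t

/-- The sub-MDP on an end-component. -/
def restrict (C : Finset S) (hC : M.IsEC C) : MDP {s : S // s ∈ C} where
  E a b := M.E a b
  nonblocking := by
    rintro ⟨s, hs⟩
    by_cases h : s ∈ M.S1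
    · obtain ⟨t, ht, hst⟩ := hC.stay s hs h
      exact ⟨⟨t, ht⟩, hst⟩
    · obtain ⟨t, hst⟩ := M.nonblocking s
      exact ⟨⟨t, hC.closed s hs h t hst⟩, hst⟩
  S1 := {a | a.1 ∈ M.S1}
  δ a :=
    { prob := fun b => (M.δ ⟨a.1.1, a.2⟩).prob b.1
      nonneg := fun b => (M.δ ⟨a.1.1, a.2⟩).nonneg b.1
      sum_eq_one := by
        have h := (M.δ ⟨a.1.1, a.2⟩).sum_eq_one
        rw [← Finset.sum_subset (Finset.subset_univ C)] at h
        · rw [← Finset.sum_coe_sort] at h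
          exact h
        · intro t _ ht
          by_contra hne
          exact ht (hC.closed a.1.1 a.1.2 a.2 t ((M.supp_δ ⟨a.1.1, a.2⟩ t).1
            (lt_of_le_of_ne ((M.δ ⟨a.1.1, a.2⟩).nonneg t) (Ne.symm hne)))) }
  supp_δ := fun a b => M.supp_δ ⟨a.1.1, a.2⟩ b.1

/-- `lam` witnesses `AS(p1) ∧ AS(p2)` from `s`. -/
def IsWitness {M : MDP S} [MeasurableSpace S] [MeasurableSingletonClass S] (lam : M.Strategy)
    (s : S) (p1 p2 : S → ℕ) : Prop :=
  Pr lam s (M.Parity p1) = 1 ∧ Pr lam s (M.Parity p2) = 1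

/-- Condition `(2_U)` of an end-component `C`: from every state of `C`, some strategy in the
sub-MDP on `C` ensures both parity objectives almost surely. -/
def Cond2U [MeasurableSpace S] [MeasurableSingletonClass S] (C : Finset S) (hC : M.IsEC C)
    (p1 p2 : S → ℕ) : Prop :=
  ∀ s : {s : S // s ∈ C}, ∃ lam : (M.restrict C hC).Strategy,
    IsWitness lam s (fun x => p1 x.1) (fun x => p2 x.1)

end MDP

/-- `D^max_even(p)`: the states of `D` with an even priority larger than all odd priorities
in `D`. -/
def maxEven {S : Type*} (D : Finset S) (p : S → ℕ) : Set S :=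
  {s | s ∈ D ∧ Even (p s) ∧ ∀ t ∈ D, Odd (p t) → p t < p s}

/-! ## Polynomial time

The machine model is the language WHILE of N. D. Jones (*Computability and Complexity from a
Programming Perspective*): structured programs over binary trees, with unit-cost access to the
constructor `cons` and the destructors `hd`, `tl` (on a pointer machine or a RAM each of them is a
constant-time operation, since subtrees are shared). The only test is whether a tree is `nil`.
Polynomial time in this model is polynomial time on Turing machines. -/

/-- The data: binary trees. -/
inductive Tree2 where
  | nil : Tree2
  | cons : Tree2 → Tree2 → Tree2

namespace Tree2

/-- The number of nodes, leaves included. -/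
def size : Tree2 → ℕ
  | nil => 1
  | cons a b => a.size + b.size + 1

def hd : Tree2 → Tree2
  | nil => nil
  | cons a _ => a

def tl : Tree2 → Tree2
  | nil => nil
  | cons _ b => b

end Tree2

namespace WHILE

/-- Expressions over the variables `x₀, x₁, …`. -/
inductive Expr where
  | var : ℕ → Expr
  | nil : Expr
  | cons : Expr → Expr → Expr
  | hd : Expr → Expr
  | tl : Expr → Expr

abbrev Store : Type := ℕ → Tree2

namespace Expr

def eval (σ : Store) : Expr → Tree2
  | var i => σ i
  | nil => Tree2.nil
  | cons a b => Tree2.cons (a.eval σ) (b.eval σ)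
  | hd a => (a.eval σ).hd
  | tl a => (a.eval σ).tl

/-- The number of steps of the evaluation of an expression. -/
def cost : Expr → ℕ
  | var _ => 1
  | nil => 1
  | cons a b => a.cost + b.cost + 1
  | hd a => a.cost + 1
  | tl a => a.cost + 1

end Expr

inductive Cmd where
  | skip : Cmd
  | assign : ℕ → Expr → Cmd
  | seq : Cmd → Cmd → Cmd
  | ite : Expr → Cmd → Cmd → Cmd
  | while : Expr → Cmd → Cmd

/-- `Exec c σ σ' t`: the command `c`, started in the store `σ`, terminates in the store `σ'`
after `t` steps. -/
inductive Exec : Cmd → Store → Store → ℕ → Prop where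
  | skip (σ : Store) : Exec Cmd.skip σ σ 1
  | assign (i : ℕ) (e : Expr) (σ : Store) :
      Exec (Cmd.assign i e) σ (Function.update σ i (e.eval σ)) (e.cost + 1)
  | seq {c d : Cmd} {σ σ' σ'' : Store} {t u : ℕ} :
      Exec c σ σ' t → Exec d σ' σ'' u → Exec (Cmd.seq c d) σ σ'' (t + u)
  | ite_true {e : Expr} {c d : Cmd} {σ σ' : Store} {t : ℕ} :
      e.eval σ ≠ Tree2.nil → Exec c σ σ' t → Exec (Cmd.ite e c d) σ σ' (e.cost + t + 1)
  | ite_false {e : Expr} {c d : Cmd} {σ σ' : Store} {t : ℕ} :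
      e.eval σ = Tree2.nil → Exec d σ σ' t → Exec (Cmd.ite e c d) σ σ' (e.cost + t + 1)
  | while_true {e : Expr} {c : Cmd} {σ σ' σ'' : Store} {t u : ℕ} :
      e.eval σ ≠ Tree2.nil → Exec c σ σ' t → Exec (Cmd.while e c) σ' σ'' u →
        Exec (Cmd.while e c) σ σ'' (e.cost + t + u + 1)
  | while_false {e : Expr} {c : Cmd} {σ : Store} :
      e.eval σ = Tree2.nil → Exec (Cmd.while e c) σ σ (e.cost + 1)

/-- The initial store: the input is in `x₀`, all other variables are `nil`. -/
def initStore (d : Tree2) : Store := fun i => if i = 0 then d else Tree2.nil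

/-- A property of instances with encoding `enc` is decidable in polynomial time: some program halts
on every encoded instance, within a number of steps that is polynomial in the size of the encoding,
and its output (the final value of `x₀`) is different from `nil` exactly on the instances that
have the property. -/
def PolyTimeDecidable {α : Type*} (enc : α → Tree2) (P : α → Prop) : Prop :=
  ∃ (c : Cmd) (q : Polynomial ℕ), ∀ a : α, ∃ (σ : Store) (t : ℕ),
    Exec c (initStore (enc a)) σ t ∧ t ≤ q.eval (enc a).size ∧ (σ 0 ≠ Tree2.nil ↔ P a)

end WHILE

/-! ## Encoding of instances -/

def encBool : Bool → Tree2
  | false => Tree2.nil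
  | true => Tree2.cons Tree2.nil Tree2.nil

def encList {α : Type*} (enc : α → Tree2) : List α → Tree2
  | [] => Tree2.nil
  | a :: l => Tree2.cons (enc a) (encList enc l)

/-- Natural numbers in binary, least significant bit first. -/
def encNat (n : ℕ) : Tree2 := encList encBool n.bits

/-- Non-negative rational numbers, as numerator and denominator in binary. -/
def encRat (q : ℚ) : Tree2 := Tree2.cons (encNat q.num.natAbs) (encNat q.den)

/-- A table of encoded entries, indexed by `Fin n`, as the list of its entries. -/
def encFun {n : ℕ} (f : Fin n → Tree2) : Tree2 := encList id (List.ofFn f)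

/-- An instance of the decision problem: an MDP with states `0, …, n - 1`, one of its
end-components and two priority functions. -/
structure Instance2U where
  n : ℕ
  M : MDP (Fin n)
  C : Finset (Fin n)
  isEC : M.IsEC C
  p1 : Fin n → ℕ
  p2 : Fin n → ℕ

open Classical in
/-- The encoding: adjacency matrix, indicator list of the states of player 1, table of the
transition probabilities (with an empty row for a state of player 1), indicator list of the
end-component, and the two lists of priorities. -/
noncomputable def Instance2U.encode (I : Instance2U) : Tree2 :=
  encList id
    [ encFun (fun s => encFun (fun t => encBool (decide (I.M.E s t)))),
      encFun (fun s => encBool (decide (s ∈ I.M.S1))),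
      encFun (fun s => if h : s ∈ I.M.S1 then Tree2.nil
        else encFun (fun t => encRat ((I.M.δ ⟨s, h⟩).prob t))),
      encFun (fun s => encBool (decide (s ∈ I.C))),
      encFun (fun s => encNat (I.p1 s)),
      encFun (fun s => encNat (I.p2 s)) ]

/-- Condition `(2_U)` holds for the end-component of the instance. -/
def Instance2U.Holds (I : Instance2U) : Prop := I.M.Cond2U I.C I.isEC I.p1 I.p2

/-! ### Almost-sure properties of plays -/

namespace MDP

open Filter Preorder

variable {S : Type*} [Fintype S] {M : MDP S}

/-! Condition `(2_U)` is equivalent to a purely graph-theoretic one: C contains an end-component D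
whose largest p1-priority and largest p2-priority are both even (`cond2U_iff`). Non-emptiness of
`maxEven` expresses exactly this evenness.

Necessity: under any strategy, Lévy's conditional Borel–Cantelli lemma shows that almost surely all
successors of a recurrent stochastic state are recurrent, so the set of states seen infinitely often
is almost surely an end-component (`ae_infStates_closed`, `isEC_infStates`). If both parity
objectives hold almost surely, a single play has all these properties at once, and its recurrent
states form D.

Sufficiency: move uniformly at random until D is entered, then uniformly along edges that stay in D
(`uniformStrategy`). This is memoryless, so each edge in use has a fixed positive probability, and
Borel–Cantelli carries recurrence along every such edge. Since D is reachable from everywhere, is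
never left and is strongly connected, exactly the states of D recur
(`ae_infStates_uniformStrategy`). Both objectives follow, and continuity of measure gives the visit
to `maxEven` within n steps up to ε.

Decision: try all pairs u, v as the states where D attains its two maxima. Then D lies among the
states of C with priorities bounded by those of u and v. The largest end-component through u in that
set is a greatest fixpoint, reached after at most n rounds of deletion, and it remains to test that
it contains u and v (`mem_iterate_ecStep`, `exists_isEC_maxEven_iff`). Transition probabilities are
never read.

Running time: the procedure is composed of tree operations under which `PolyFun` is closed. Its
outer loops iterate on Boolean tables of bounded size, so iteration causes no blow-up. -/

theorem next_of_mem (lam : M.Strategy) {n : ℕ} {ρ : Prefix S n} (h : ρ.last ∈ M.S1) :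
    next lam n ρ = lam.act n ρ h := by
  simp [next, h]

theorem next_of_notMem (lam : M.Strategy) {n : ℕ} {ρ : Prefix S n} (h : ρ.last ∉ M.S1) :
    next lam n ρ = M.δ ⟨ρ.last, h⟩ := by
  simp [next, h]

theorem edge_of_prob_pos (lam : M.Strategy) {n : ℕ} {ρ : Prefix S n} {t : S}
    (h : 0 < (next lam n ρ).prob t) : M.E ρ.last t := by
  by_cases hs : ρ.last ∈ M.S1
  · rw [next_of_mem lam hs] at h
    exact lam.supp_act n ρ hs t h
  · rw [next_of_notMem lam hs] at h
    exact (M.supp_δ ⟨_, hs⟩ t).1 h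

theorem infStates_nonempty (π : ℕ → S) : (infStates π).Nonempty := by
  obtain ⟨s, hs⟩ := Finite.exists_infinite_fiber π
  refine ⟨s, fun i => ?_⟩
  obtain ⟨j, hj, hij⟩ := (Set.infinite_coe_iff.1 hs).exists_gt i
  exact ⟨j, hij.le, hj⟩

/-- Each of the finitely many non-recurrent states has a last visit; N lies beyond all of them. -/
theorem eventually_mem_infStates (π : ℕ → S) : ∃ N, ∀ j ≥ N, π j ∈ infStates π := by
  have h : ∀ s : S, ∀ᶠ j in atTop, π j = s → s ∈ infStates π := by
    intro s
    by_cases hs : s ∈ infStates π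
    · simp [hs]
    · simp only [infStates, Set.mem_ofPred_eq, not_forall, not_exists, not_and] at hs
      obtain ⟨i, hi⟩ := hs
      filter_upwards [eventually_ge_atTop i] with j hj hjs
      exact absurd hjs (hi j hj)
  obtain ⟨N, hN⟩ := eventually_atTop.1 (eventually_all.2 h)
  exact ⟨N, fun j hj => hN j hj _ rfl⟩

section Probability

variable [MeasurableSpace S] [MeasurableSingletonClass S]

instance isProbabilityMeasure_Pr (lam : M.Strategy) (s : S) : IsProbabilityMeasure (Pr lam s) :=
  inferInstanceAs (IsProbabilityMeasure
    (Kernel.traj (X := fun _ => S) (stepKernel lam) 0 (fun _ => s)))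

theorem _root_.RatDist.toMeasure_real_singleton (d : RatDist S) (t : S) :
    d.toMeasure.real {t} = d.prob t := by
  classical
  have hd : (0 : ℝ) ≤ d.prob t := by exact_mod_cast d.nonneg t
  have h : ∀ a, ENNReal.ofReal (d.prob a : ℝ) * Set.indicator {t} (1 : S → ENNReal) a
      = if a = t then ENNReal.ofReal (d.prob t : ℝ) else 0 := by
    intro a
    by_cases h : a = t
    · subst h; simp
    · simp [h]
  have h2 : d.toMeasure {t} = ENNReal.ofReal (d.prob t : ℝ) := by
    simp only [RatDist.toMeasure, Measure.coe_finsetSum, Measure.coe_smul, Finset.sum_apply,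
      Pi.smul_apply, Measure.dirac_apply, smul_eq_mul, h, Finset.sum_ite_eq', Finset.mem_univ,
      if_true]
  rw [Measure.real, h2, ENNReal.toReal_ofReal hd]

theorem traj_real_succ (lam : M.Strategy) (k : ℕ) (ρ : Prefix S k) (t : S) :
    (Kernel.traj (X := fun _ => S) (stepKernel lam) k ρ).real {π | π (k + 1) = t}
      = (next lam k ρ).prob t := by
  have h := Kernel.map_traj_succ_self (X := fun _ => S) (κ := stepKernel lam) (a := k)
  have h2 := congrArg (fun κ => (κ ρ).real {t}) h
  rw [Kernel.map_apply _ (by fun_prop)] at h2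
  rw [map_measureReal_apply (by fun_prop) (measurableSet_singleton t)] at h2
  rw [← RatDist.toMeasure_real_singleton]
  exact h2

theorem measurableSet_piLE_eq (k : ℕ) (t : S) :
    MeasurableSet[Filtration.piLE (X := fun _ : ℕ => S) k] {π | π k = t} := by
  rw [Filtration.piLE_eq_comap_frestrictLe]
  refine ⟨{ρ | ρ ⟨k, Finset.mem_Iic.2 le_rfl⟩ = t}, ?_, rfl⟩
  exact measurableSet_eq_fun (by fun_prop) measurable_const

theorem measurableSet_coord_eq (k : ℕ) (t : S) : MeasurableSet {π : ℕ → S | π k = t} :=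
  (Filtration.piLE (X := fun _ : ℕ => S)).le k _ (measurableSet_piLE_eq k t)

theorem condExp_coord_succ (lam : M.Strategy) (s t : S) (k : ℕ) :
    (Pr lam s)[({π : ℕ → S | π (k + 1) = t}).indicator (1 : (ℕ → S) → ℝ) |
      Filtration.piLE (X := fun _ : ℕ => S) k]
      =ᵐ[Pr lam s] fun π => ((next lam k (playPrefix π k)).prob t : ℝ) := by
  have hi : Integrable (({π : ℕ → S | π (k + 1) = t}).indicator (1 : (ℕ → S) → ℝ))
      (Kernel.traj (X := fun _ => S) (stepKernel lam) 0 (fun _ => s)) :=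
    (integrable_const (1 : ℝ)).indicator (measurableSet_coord_eq (k + 1) t)
  refine (Kernel.condExp_traj (Nat.zero_le k) hi).trans (Eventually.of_forall fun π => ?_)
  simp only
  rw [integral_indicator_one (measurableSet_coord_eq (k + 1) t), traj_real_succ]
  rfl

/-- Lévy's extension of the Borel–Cantelli lemma, for transitions of an MDP. -/
theorem ae_infStates_of_prob_ge (lam : M.Strategy) (s₀ s t : S) (c : ℝ) (hc : 0 < c)
    (h : ∀ n (ρ : Prefix S n), ρ.last = s → c ≤ ((next lam n ρ).prob t : ℝ)) :
    ∀ᵐ π ∂(Pr lam s₀), s ∈ infStates π → t ∈ infStates π := by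
  have h1 := ae_mem_limsup_atTop_iff (ℱ := Filtration.piLE (X := fun _ : ℕ => S)) (Pr lam s₀)
    (s := fun k => {π : ℕ → S | π k = t}) (fun n => measurableSet_piLE_eq n t)
  have h2 : ∀ᵐ π ∂(Pr lam s₀), ∀ k, _ := ae_all_iff.2 (fun k => condExp_coord_succ lam s₀ t k)
  filter_upwards [h1, h2] with π h1 h2 hs
  suffices hl : π ∈ limsup (fun k => {π : ℕ → S | π k = t}) atTop by
    rw [mem_limsup_iff_frequently_mem, frequently_atTop] at hl
    exact fun i => hl i
  rw [h1]
  simp only [h2]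
  have hnn : ∀ k, (0 : ℝ) ≤ ((next lam k (playPrefix π k)).prob t : ℝ) := fun k => by
    exact_mod_cast (next lam k (playPrefix π k)).nonneg t
  have hfr : ∃ᶠ k in atTop, c ≤ ((next lam k (playPrefix π k)).prob t : ℝ) := by
    rw [frequently_atTop]
    intro i
    obtain ⟨j, hj, hjs⟩ := hs i
    exact ⟨j, hj, h j _ hjs⟩
  -- The transition probabilities are non-negative: if their sum does not diverge, they are summable
  -- and tend to 0, although they are at least c infinitely often.
  by_contra hcon
  have hsum : Summable fun k => ((next lam k (playPrefix π k)).prob t : ℝ) := by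
    by_contra hns
    exact hcon ((not_summable_iff_tendsto_nat_atTop_of_nonneg hnn).1 hns)
  have hlt := hsum.tendsto_atTop_zero.eventually (gt_mem_nhds hc)
  obtain ⟨k, hk, hk'⟩ := (hfr.and_eventually hlt).exists
  exact absurd hk' (not_lt.2 hk)

theorem ae_prob_pos (lam : M.Strategy) (s : S) :
    ∀ᵐ π ∂(Pr lam s), ∀ n, 0 < (next lam n (playPrefix π n)).prob (π (n + 1)) := by
  rw [ae_all_iff]
  intro n
  have key : ∀ t, ∀ᵐ π ∂(Pr lam s), π (n + 1) = t → 0 < (next lam n (playPrefix π n)).prob t := by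
    intro t
    have hA : MeasurableSet[Filtration.piLE (X := fun _ : ℕ => S) n]
        {π | (next lam n (playPrefix π n)).prob t = 0} := by
      rw [Filtration.piLE_eq_comap_frestrictLe]
      exact ⟨{ρ | (next lam n ρ).prob t = 0}, Set.Countable.measurableSet (Set.to_countable _), rfl⟩
    have hA' := (Filtration.piLE (X := fun _ : ℕ => S)).le n _ hA
    have hB := measurableSet_coord_eq (n + 1) t
    -- Integrate the conditional probability of moving to t over the event that this probability
    -- vanishes: moving to t there has measure 0.
    have h1 := setIntegral_condExp (μ := Pr lam s)
      (f := ({π : ℕ → S | π (n + 1) = t}).indicator (1 : (ℕ → S) → ℝ))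
      ((Filtration.piLE (X := fun _ : ℕ => S)).le n)
      ((integrable_const (1 : ℝ)).indicator hB) hA
    rw [setIntegral_congr_ae (g := fun _ => (0 : ℝ)) hA'
      ((condExp_coord_succ lam s t n).mono fun π hπ hm => by
        simpa [hπ] using hm)] at h1
    rw [integral_indicator_one hB, measureReal_restrict_apply hB] at h1
    simp only [integral_zero] at h1
    have h2 := (measureReal_eq_zero_iff (by finiteness)).1 h1.symm
    rw [ae_iff]
    refine measure_mono_null ?_ h2
    intro π hπ
    simp only [Set.mem_ofPred_eq, Classical.not_imp, not_lt] at hπ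
    exact ⟨hπ.1, le_antisymm hπ.2 ((next lam n (playPrefix π n)).nonneg t)⟩
  filter_upwards [ae_all_iff.2 key] with π hπ
  exact hπ _ rfl

theorem ae_mem_Out (lam : M.Strategy) (s : S) : ∀ᵐ π ∂(Pr lam s), π ∈ Out lam := by
  filter_upwards [ae_prob_pos lam s] with π hπ
  refine ⟨fun i => edge_of_prob_pos lam (hπ i), fun n h => ?_⟩
  rw [← next_of_mem lam h]
  exact hπ n

theorem Pr_eq_one_iff (lam : M.Strategy) (s : S) {A : Set (ℕ → S)}
    (h : ∀ᵐ π ∂(Pr lam s), π ∈ A) : Pr lam s A = 1 :=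
  le_antisymm prob_le_one (by
    rw [← measure_univ (μ := Pr lam s)]
    exact measure_mono_ae (h.mono fun _ hπ _ => hπ))

theorem ae_infStates_closed (lam : M.Strategy) (s₀ : S) :
    ∀ᵐ π ∂(Pr lam s₀), ∀ s t, s ∉ M.S1 → M.E s t → s ∈ infStates π → t ∈ infStates π := by
  simp only [ae_all_iff, eventually_imp_distrib_left]
  intro s t hs hst
  refine ae_infStates_of_prob_ge lam s₀ s t ((M.δ ⟨s, hs⟩).prob t : ℝ) ?_ ?_
  · exact_mod_cast (M.supp_δ ⟨s, hs⟩ t).2 hst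
  · rintro n ρ rfl
    rw [next_of_notMem lam hs]

end Probability

/-- From some time on the play visits only recurrent states, and it returns to each of them. Its own
segments therefore supply the required connecting paths and the successor at a state of player 1. -/
theorem isEC_infStates {π : ℕ → S} (hπ : π ∈ M.Plays)
    (hcl : ∀ s t, s ∉ M.S1 → M.E s t → s ∈ infStates π → t ∈ infStates π)
    {D : Finset S} (hD : (D : Set S) = infStates π) : M.IsEC D := by
  have hm : ∀ s, s ∈ D ↔ s ∈ infStates π := fun s => by rw [← hD]; rfl
  obtain ⟨N, hN⟩ := eventually_mem_infStates π
  have hpath : ∀ i ≥ N, ∀ k, Relation.ReflTransGen (fun a b => a ∈ D ∧ b ∈ D ∧ M.E a b)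
      (π i) (π (i + k)) := by
    intro i hi k
    induction k with
    | zero => exact .refl
    | succ k ih =>
      exact ih.tail ⟨(hm _).2 (hN _ (by omega)), (hm _).2 (hN _ (by omega)), hπ _⟩
  refine ⟨?_, ?_, ?_, ?_⟩
  · rw [← Finset.coe_nonempty, hD]; exact infStates_nonempty π
  · intro s hs h1 t ht
    exact (hm t).2 (hcl s t h1 ht ((hm s).1 hs))
  · intro s hs _
    obtain ⟨j, hj, rfl⟩ := (hm s).1 hs N
    exact ⟨π (j + 1), (hm _).2 (hN _ (by omega)), hπ j⟩
  · intro s hs t ht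
    obtain ⟨j, hj, rfl⟩ := (hm s).1 hs N
    obtain ⟨i, hi, rfl⟩ := (hm t).1 ht j
    obtain ⟨k, rfl⟩ := Nat.exists_eq_add_of_le hi
    exact hpath j hj k

end MDP

open Classical in
/-- The uniform distribution on a non-empty finite set. -/
noncomputable def RatDist.uniform {A : Type*} [Fintype A] (F : Finset A) (hF : F.Nonempty) :
    RatDist A where
  prob a := if a ∈ F then (F.card : ℚ)⁻¹ else 0
  nonneg a := by split_ifs <;> positivity
  sum_eq_one := by
    have : (F.card : ℚ) ≠ 0 := by exact_mod_cast hF.card_pos.ne'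
    simp [this]

theorem RatDist.uniform_prob_pos {A : Type*} [Fintype A] {F : Finset A} {hF : F.Nonempty} {a : A} :
    0 < (RatDist.uniform F hF).prob a ↔ a ∈ F := by
  by_cases h : a ∈ F
  · simpa [RatDist.uniform, h] using hF
  · simp [RatDist.uniform, h]

theorem maxEven_nonempty_of_max {S : Type*} {D : Finset S} {p : S → ℕ} {s : S} (hs : s ∈ D)
    (he : Even (p s)) (hm : ∀ t ∈ D, p t ≤ p s) : (maxEven D p).Nonempty :=
  ⟨s, hs, he, fun t ht ho => lt_of_le_of_ne (hm t ht) fun h =>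
    (Nat.not_even_iff_odd.2 ho) (h ▸ he)⟩

/-- A state of maximal priority cannot be odd, as it would then lie strictly below an element of
`maxEven`. -/
theorem exists_max_of_maxEven_nonempty {S : Type*} {D : Finset S} {p : S → ℕ}
    (h : (maxEven D p).Nonempty) : ∃ s ∈ D, Even (p s) ∧ ∀ t ∈ D, p t ≤ p s := by
  obtain ⟨s, hs, _, ho⟩ := h
  obtain ⟨m, hm, hmax⟩ := D.exists_max_image p ⟨s, hs⟩
  refine ⟨m, hm, ?_, hmax⟩
  by_contra hne
  exact absurd (hmax s hs) (not_le.2 (ho m hm (Nat.not_even_iff_odd.1 hne)))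

theorem maxEven_map_subtype_nonempty {S : Type*} {C : Finset S} {D : Finset {s : S // s ∈ C}} {p : S → ℕ}
    (h : (maxEven D (fun x => p x.1)).Nonempty) :
    (maxEven (D.map (Function.Embedding.subtype _)) p).Nonempty := by
  obtain ⟨s, hs, he, ho⟩ := h
  refine ⟨s, Finset.mem_map_of_mem (Function.Embedding.subtype _) hs, he, fun t ht hto => ?_⟩
  obtain ⟨y, hy, rfl⟩ := Finset.mem_map.1 ht
  exact ho y hy hto

open scoped Classical in
theorem exists_mem_maxEven_subtype {S : Type*} {C : Finset S} {D : Finset S} {p : S → ℕ} (hDC : D ⊆ C)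
    (h : (maxEven D p).Nonempty) :
    ∃ x ∈ maxEven (D.subtype (· ∈ C)) (fun x => p x.1), (x : S) ∈ maxEven D p := by
  obtain ⟨s, hs, he, ho⟩ := h
  exact ⟨⟨s, hDC hs⟩, ⟨Finset.mem_subtype.2 hs, he, fun t ht hto =>
    ho t (Finset.mem_subtype.1 ht) hto⟩, hs, he, ho⟩

/-! ### A memoryless strategy that settles in a given end-component -/

namespace MDP

open Filter Preorder

variable {S : Type*} [Fintype S] {M : MDP S}

/-- The edges used by the strategy that moves randomly until it reaches `D`, and randomly
within `D` from then on. -/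
def GoodEdge (M : MDP S) (D : Finset S) (s t : S) : Prop := M.E s t ∧ (s ∈ D → t ∈ D)

theorem IsEC.exists_goodEdge {D : Finset S} (hD : M.IsEC D) (s : S) (hs : s ∈ M.S1) :
    ∃ t, GoodEdge M D s t := by
  by_cases h : s ∈ D
  · obtain ⟨t, ht, hst⟩ := hD.stay s h hs
    exact ⟨t, hst, fun _ => ht⟩
  · obtain ⟨t, ht⟩ := M.nonblocking s
    exact ⟨t, ht, fun h' => absurd h' h⟩

open Classical in
/-- The uniform distribution on the targets of the good edges. -/
noncomputable def goodDist (D : Finset S) (hD : M.IsEC D) (s : {s : S // s ∈ M.S1}) : RatDist S :=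
  RatDist.uniform (Finset.univ.filter (GoodEdge M D s)) (Finset.filter_nonempty_iff.2
    ((hD.exists_goodEdge _ s.2).imp fun _ ht => ⟨Finset.mem_univ _, ht⟩))

theorem goodDist_prob_pos {D : Finset S} {hD : M.IsEC D} {s : {s : S // s ∈ M.S1}} {t : S} :
    0 < (goodDist D hD s).prob t ↔ GoodEdge M D s t := by
  rw [goodDist, RatDist.uniform_prob_pos]
  simp

/-- Play uniformly at random along the good edges. -/
noncomputable def uniformStrategy (D : Finset S) (hD : M.IsEC D) : M.Strategy where
  act _ ρ h := goodDist D hD ⟨ρ.last, h⟩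
  supp_act _ _ _ _ ht := (goodDist_prob_pos.1 ht).1

theorem uniformStrategy_memoryless (D : Finset S) (hD : M.IsEC D) :
    (uniformStrategy D hD).Memoryless := by
  intro m n ρ ρ' h h' hl
  exact congrArg (goodDist D hD) (Subtype.ext hl)

/-- At stochastic states every edge is good, because an end-component contains all their successors.
Both kinds of states can thus be treated alike. -/
theorem next_uniformStrategy_pos_iff {D : Finset S} {hD : M.IsEC D} {n : ℕ} {ρ : Prefix S n}
    {t : S} : 0 < (next (uniformStrategy D hD) n ρ).prob t ↔ GoodEdge M D ρ.last t := by
  by_cases hs : ρ.last ∈ M.S1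
  · rw [next_of_mem _ hs]
    exact goodDist_prob_pos (hD := hD)
  · rw [next_of_notMem _ hs, M.supp_δ ⟨_, hs⟩]
    exact ⟨fun h => ⟨h, fun hD' => hD.closed _ hD' hs t h⟩, fun h => h.1⟩

theorem next_uniformStrategy_congr {D : Finset S} {hD : M.IsEC D} {m n : ℕ} {ρ : Prefix S m}
    {ρ' : Prefix S n} (h : ρ.last = ρ'.last) :
    next (uniformStrategy D hD) m ρ = next (uniformStrategy D hD) n ρ' := by
  by_cases hs : ρ.last ∈ M.S1
  · rw [next_of_mem _ hs, next_of_mem _ (h ▸ hs)]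
    exact uniformStrategy_memoryless D hD _ _ _ _ _ _ h
  · rw [next_of_notMem _ hs, next_of_notMem _ (h ▸ hs)]
    simp only [h]

theorem parity_of_infStates_eq {D : Finset S} {p : S → ℕ} {π : ℕ → S} (hπ : π ∈ M.Plays)
    (h : infStates π = D) (hp : (maxEven D p).Nonempty) : π ∈ M.Parity p := by
  obtain ⟨m, hm, he, hmax⟩ := exists_max_of_maxEven_nonempty hp
  exact ⟨hπ, m, by rw [h]; exact hm, he, fun t ht => hmax t (by rw [h] at ht; exact ht)⟩

/-- Cut the path at its first entry into D; outside D every edge is good. -/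
theorem reaches_via_goodEdge {D : Finset S} {s t : S} (h : Relation.ReflTransGen M.E s t)
    (ht : t ∈ D) : ∃ t' ∈ D, Relation.ReflTransGen (GoodEdge M D) s t' := by
  induction h using Relation.ReflTransGen.head_induction_on with
  | refl => exact ⟨t, ht, .refl⟩
  | @head a c hac _ ih =>
    by_cases ha : a ∈ D
    · exact ⟨a, ha, .refl⟩
    · obtain ⟨t', ht', hp⟩ := ih
      exact ⟨t', ht', .head ⟨hac, fun h => absurd h ha⟩ hp⟩

section Probability

variable [MeasurableSpace S] [MeasurableSingletonClass S]

/-- Recurrence spreads along good edges. Some state recurs, so some state of D does, so all of D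
does by connectivity. No other state recurs, since good edges never leave D. -/
theorem ae_infStates_uniformStrategy (D : Finset S) (hD : M.IsEC D)
    (hreach : ∀ s, ∃ t ∈ D, Relation.ReflTransGen M.E s t) (s₀ : S) :
    ∀ᵐ π ∂(Pr (uniformStrategy D hD) s₀), infStates π = D := by
  have hstep : ∀ᵐ π ∂(Pr (uniformStrategy D hD) s₀), ∀ s t, GoodEdge M D s t →
      s ∈ infStates π → t ∈ infStates π := by
    simp only [ae_all_iff, eventually_imp_distrib_left]
    intro s t hst
    have hl : Prefix.last (fun _ : Finset.Iic 0 => s) = s := rfl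
    -- By memorylessness the one-state history s already gives the probability valid after every
    -- history ending in s.
    refine ae_infStates_of_prob_ge _ s₀ s t
      ((next (uniformStrategy D hD) 0 (fun _ => s)).prob t : ℝ) ?_ ?_
    · exact_mod_cast next_uniformStrategy_pos_iff.2 (hl ▸ hst)
    · intro n ρ hρ
      rw [next_uniformStrategy_congr (hρ.trans hl.symm)]
  filter_upwards [hstep, ae_prob_pos (uniformStrategy D hD) s₀] with π hπ hpos
  have hpath : ∀ s t, Relation.ReflTransGen (GoodEdge M D) s t → s ∈ infStates π →
      t ∈ infStates π := by
    intro s t h hs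
    induction h with
    | refl => exact hs
    | tail _ hbc ih => exact hπ _ _ hbc ih
  have hedge : ∀ n, GoodEdge M D (π n) (π (n + 1)) := fun n =>
    next_uniformStrategy_pos_iff.1 (hpos n)
  obtain ⟨s, hs⟩ := infStates_nonempty π
  obtain ⟨t, ht, hst⟩ := hreach s
  obtain ⟨d, hd, hsd⟩ := reaches_via_goodEdge hst ht
  have hdinf := hpath s d hsd hs
  ext x
  constructor
  · intro hx
    obtain ⟨i, _, hi⟩ := hdinf 0
    have hin : ∀ k, π (i + k) ∈ D := by
      intro k
      induction k with
      | zero => rw [add_zero, hi]; exact hd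
      | succ k ih => exact (hedge (i + k)).2 ih
    obtain ⟨j, hj, rfl⟩ := hx i
    obtain ⟨k, rfl⟩ := Nat.exists_eq_add_of_le hj
    exact hin k
  · intro hx
    refine hpath d x ?_ hdinf
    exact (hD.connected d hd x hx).lift id fun a b hab => ⟨hab.2.2, fun _ => hab.2.1⟩

/-- Measurability is what allows passing from probability 1 to an almost-everywhere statement. -/
theorem measurableSet_parity (M : MDP S) (p : S → ℕ) : MeasurableSet (M.Parity p) := by
  have hinf : ∀ t : S, MeasurableSet {π : ℕ → S | t ∈ infStates π} := by
    intro t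
    have : {π : ℕ → S | t ∈ infStates π} = ⋂ i, ⋃ j, ⋃ _ : i ≤ j, {π | π j = t} := by
      ext π; simp [infStates]
    rw [this]
    exact .iInter fun i => .iUnion fun j => .iUnion fun _ => measurableSet_coord_eq j t
  have hplay : MeasurableSet M.Plays := by
    have : M.Plays = ⋂ i, ⋃ a : S, ⋃ b : S, ⋃ _ : M.E a b,
        ({π | π i = a} ∩ {π | π (i + 1) = b}) := by
      ext π; simp [Plays]
    rw [this]
    exact .iInter fun i => .iUnion fun a => .iUnion fun b => .iUnion fun _ =>
      (measurableSet_coord_eq i a).inter (measurableSet_coord_eq (i + 1) b)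
  have : M.Parity p = M.Plays ∩ ⋃ a : S, ⋃ _ : Even (p a), ({π | a ∈ infStates π} ∩
      ⋂ t : S, ⋂ _ : ¬ p t ≤ p a, {π | t ∈ infStates π}ᶜ) := by
    ext π
    simp only [Parity, Set.mem_ofPred_eq, Set.mem_inter_iff, Set.mem_iUnion, Set.mem_iInter,
      Set.mem_compl_iff]
    refine and_congr_right fun _ => exists_congr fun a => ?_
    constructor
    · rintro ⟨h1, h2, h3⟩
      exact ⟨h2, h1, fun t ht hti => ht (h3 t hti)⟩
    · rintro ⟨h2, h1, h3⟩
      exact ⟨h1, h2, fun t hti => not_not.1 fun ht => h3 t ht hti⟩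
  rw [this]
  exact hplay.inter (.iUnion fun a => .iUnion fun _ => (hinf a).inter
    (.iInter fun t => .iInter fun _ => (hinf t).compl))

theorem mem_ae_of_Pr_eq_one {lam : M.Strategy} {s : S} {A : Set (ℕ → S)} (hA : MeasurableSet A)
    (h : Pr lam s A = 1) : ∀ᵐ π ∂(Pr lam s), π ∈ A :=
  (mem_ae_iff_prob_eq_one hA).2 h

theorem exists_isEC_of_witness (lam : M.Strategy) (s : S) {p1 p2 : S → ℕ}
    (h : IsWitness lam s p1 p2) :
    ∃ D : Finset S, M.IsEC D ∧ (maxEven D p1).Nonempty ∧ (maxEven D p2).Nonempty := by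
  classical
  obtain ⟨π, ⟨hplay, a, ha, hae, ham⟩, ⟨_, b, hb, hbe, hbm⟩, hcl⟩ :=
    (Eventually.and (mem_ae_of_Pr_eq_one (M.measurableSet_parity p1) h.1)
      (Eventually.and (mem_ae_of_Pr_eq_one (M.measurableSet_parity p2) h.2)
        (ae_infStates_closed lam s))).exists
  have hm : ∀ t, t ∈ (infStates π).toFinite.toFinset ↔ t ∈ infStates π := fun t => by simp
  refine ⟨(infStates π).toFinite.toFinset, isEC_infStates hplay hcl (by simp), ?_, ?_⟩
  · exact maxEven_nonempty_of_max ((hm a).2 ha) hae fun t ht => ham t ((hm t).1 ht)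
  · exact maxEven_nonempty_of_max ((hm b).2 hb) hbe fun t ht => hbm t ((hm t).1 ht)

/-- Continuity from below: the events of a visit by time n increase to an event of probability 1. -/
theorem exists_le_measureReal_visit (lam : M.Strategy) (s : S) {A : Set S}
    (h : ∀ᵐ π ∂(Pr lam s), ∃ i, π i ∈ A) {ε : ℝ} (hε : 0 < ε) :
    ∃ n : ℕ, 1 - ε ≤ (Pr lam s).real {π | π ∈ Out lam ∧ ∃ i, i ≤ n ∧ π i ∈ A} := by
  set B : ℕ → Set (ℕ → S) := fun n => {π | π ∈ Out lam ∧ ∃ i, i ≤ n ∧ π i ∈ A}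
  have hmono : Monotone B := fun m n hmn π ⟨ho, i, hi, hA⟩ => ⟨ho, i, hi.trans hmn, hA⟩
  have hU : Pr lam s (⋃ n, B n) = 1 := by
    refine Pr_eq_one_iff lam s ?_
    filter_upwards [h, ae_mem_Out lam s] with π ⟨i, hi⟩ ho
    exact Set.mem_iUnion.2 ⟨i, ho, i, le_rfl, hi⟩
  have ht := tendsto_measure_iUnion_atTop (μ := Pr lam s) hmono
  rw [hU] at ht
  have ht' := (ENNReal.tendsto_toReal ENNReal.one_ne_top).comp ht
  obtain ⟨n, hn⟩ := (ht'.eventually (lt_mem_nhds (show 1 - ε < (1 : ENNReal).toReal by simpa))).exists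
  exact ⟨n, hn.le⟩

end Probability

/-! ### Transfer between the MDP and its restriction to C -/

section Restrict

open scoped Classical

variable {C : Finset S} {hC : M.IsEC C}

theorem restrict_reachable (s t : {s : S // s ∈ C}) :
    Relation.ReflTransGen (M.restrict C hC).E s t := by
  have key : ∀ a b, Relation.ReflTransGen (fun a b => a ∈ C ∧ b ∈ C ∧ M.E a b) a b →
      ∀ (ha : a ∈ C) (hb : b ∈ C), Relation.ReflTransGen (M.restrict C hC).E ⟨a, ha⟩ ⟨b, hb⟩ := by
    intro a b h ha
    induction h with
    | refl => intro _; exact .refl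
    | tail _ hbc ih => intro hc; exact (ih hbc.1).tail hbc.2.2
  exact key s t (hC.connected s s.2 t t.2) s.2 t.2

theorem isEC_map_of_restrict {D : Finset {s : S // s ∈ C}} (hD : (M.restrict C hC).IsEC D) :
    M.IsEC (D.map (Function.Embedding.subtype _)) := by
  have hm : ∀ {x : {s : S // s ∈ C}}, x ∈ D →
      (x : S) ∈ D.map (Function.Embedding.subtype _) := fun hx =>
    Finset.mem_map_of_mem (Function.Embedding.subtype _) hx
  refine ⟨hD.nonempty.map, ?_, ?_, ?_⟩
  · intro s hs h1 t hst
    obtain ⟨x, hx, rfl⟩ := Finset.mem_map.1 hs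
    exact hm (x := ⟨t, hC.closed x x.2 h1 t hst⟩) (hD.closed x hx h1 _ hst)
  · intro s hs h1
    obtain ⟨x, hx, rfl⟩ := Finset.mem_map.1 hs
    obtain ⟨t, ht, hst⟩ := hD.stay x hx h1
    exact ⟨t, hm ht, hst⟩
  · intro s hs t ht
    obtain ⟨x, hx, rfl⟩ := Finset.mem_map.1 hs
    obtain ⟨y, hy, rfl⟩ := Finset.mem_map.1 ht
    exact (hD.connected x hx y hy).lift Subtype.val fun a b h => ⟨hm h.1, hm h.2.1, h.2.2⟩

theorem isEC_subtype_of_subset {D : Finset S} (hD : M.IsEC D) (hDC : D ⊆ C) :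
    (M.restrict C hC).IsEC (D.subtype (· ∈ C)) := by
  refine ⟨?_, ?_, ?_, ?_⟩
  · obtain ⟨s, hs⟩ := hD.nonempty
    exact ⟨⟨s, hDC hs⟩, by simpa using hs⟩
  · rintro ⟨s, hsC⟩ hs h1 t hst
    exact Finset.mem_subtype.2 (hD.closed s (Finset.mem_subtype.1 hs) h1 _ hst)
  · rintro ⟨s, hsC⟩ hs h1
    obtain ⟨t, ht, hst⟩ := hD.stay s (Finset.mem_subtype.1 hs) h1
    exact ⟨⟨t, hDC ht⟩, Finset.mem_subtype.2 ht, hst⟩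
  · have key : ∀ a b, Relation.ReflTransGen (fun a b => a ∈ D ∧ b ∈ D ∧ M.E a b) a b →
        ∀ (ha : a ∈ C) (hb : b ∈ C), Relation.ReflTransGen
          (fun a b => a ∈ D.subtype (· ∈ C) ∧ b ∈ D.subtype (· ∈ C) ∧ (M.restrict C hC).E a b)
          ⟨a, ha⟩ ⟨b, hb⟩ := by
      intro a b h ha
      induction h with
      | refl => intro _; exact .refl
      | tail _ hbc ih =>
        intro hc
        exact (ih (hDC hbc.1)).tail
          ⟨Finset.mem_subtype.2 hbc.1, Finset.mem_subtype.2 hbc.2.1, hbc.2.2⟩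
    intro s hs t ht
    exact key s t (hD.connected s (Finset.mem_subtype.1 hs) t (Finset.mem_subtype.1 ht)) s.2 t.2

variable [MeasurableSpace S] [MeasurableSingletonClass S]

theorem exists_isEC_of_cond2U {p1 p2 : S → ℕ} (h : M.Cond2U C hC p1 p2) :
    ∃ D : Finset S, M.IsEC D ∧ D ⊆ C ∧ (maxEven D p1).Nonempty ∧ (maxEven D p2).Nonempty := by
  obtain ⟨s, hs⟩ := hC.nonempty
  obtain ⟨lam, hlam⟩ := h ⟨s, hs⟩
  obtain ⟨D, hD, h1, h2⟩ := exists_isEC_of_witness lam _ hlam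
  refine ⟨D.map (Function.Embedding.subtype _), isEC_map_of_restrict hD, ?_,
    maxEven_map_subtype_nonempty h1, maxEven_map_subtype_nonempty h2⟩
  intro x hx
  obtain ⟨y, -, rfl⟩ := Finset.mem_map.1 hx
  exact y.2

theorem exists_memoryless_witness {D : Finset S} (hD : M.IsEC D) (hDC : D ⊆ C) {p1 p2 : S → ℕ}
    (h1 : (maxEven D p1).Nonempty) (h2 : (maxEven D p2).Nonempty) :
    ∃ lam : (M.restrict C hC).Strategy, lam.Memoryless ∧
      (∀ s, IsWitness lam s (fun x => p1 x.1) (fun x => p2 x.1)) ∧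
      (∀ s, Pr lam s {π | π ∈ Out lam ∧ Subtype.val '' infStates π = (D : Set S)} = 1) ∧
      ∀ s, ∀ ε : ℝ, 0 < ε → ∃ n : ℕ, 1 - ε ≤ (Pr lam s).real
        {π | π ∈ Out lam ∧ ∃ i, i ≤ n ∧ (π i : S) ∈ maxEven D p1} := by
  have hD' := isEC_subtype_of_subset (hC := hC) hD hDC
  have hreach : ∀ s, ∃ t ∈ D.subtype (· ∈ C), Relation.ReflTransGen (M.restrict C hC).E s t := by
    obtain ⟨t, ht⟩ := hD'.nonempty
    exact fun s => ⟨t, ht, restrict_reachable s t⟩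
  have hae := ae_infStates_uniformStrategy _ hD' hreach
  obtain ⟨x1, hx1, hx1D⟩ := exists_mem_maxEven_subtype hDC h1
  obtain ⟨x2, hx2, hx2D⟩ := exists_mem_maxEven_subtype hDC h2
  refine ⟨uniformStrategy _ hD', uniformStrategy_memoryless _ _, fun s => ⟨?_, ?_⟩,
    fun s => ?_, fun s ε hε => ?_⟩
  · refine Pr_eq_one_iff _ s ?_
    filter_upwards [hae s, ae_mem_Out _ s] with π hπ ho
    exact parity_of_infStates_eq ho.1 hπ ⟨x1, hx1⟩
  · refine Pr_eq_one_iff _ s ?_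
    filter_upwards [hae s, ae_mem_Out _ s] with π hπ ho
    exact parity_of_infStates_eq ho.1 hπ ⟨x2, hx2⟩
  · refine Pr_eq_one_iff _ s ?_
    filter_upwards [hae s, ae_mem_Out _ s] with π hπ ho
    refine ⟨ho, ?_⟩
    rw [hπ]
    ext t
    simpa using @hDC t
  · refine exists_le_measureReal_visit (A := {x | (x : S) ∈ maxEven D p1}) _ s ?_ hε
    filter_upwards [hae s] with π hπ
    have : x1 ∈ infStates π := by rw [hπ]; exact hx1.1
    obtain ⟨i, -, hi⟩ := this 0
    exact ⟨i, by rw [hi]; exact hx1D⟩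

/-- This removes strategies and probabilities from the decision problem. -/
theorem cond2U_iff {p1 p2 : S → ℕ} : M.Cond2U C hC p1 p2 ↔
    ∃ D : Finset S, M.IsEC D ∧ D ⊆ C ∧ (maxEven D p1).Nonempty ∧ (maxEven D p2).Nonempty := by
  refine ⟨exists_isEC_of_cond2U, ?_⟩
  rintro ⟨D, hD, hDC, h1, h2⟩ s
  obtain ⟨lam, -, h, -⟩ := exists_memoryless_witness (hC := hC) hD hDC h1 h2
  exact ⟨lam, h s⟩

end Restrict

end MDP

/-! ### Polynomial-time functions on trees -/

/-- A monotone function that is bounded by a polynomial. -/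
def PolyBdd (b : ℕ → ℕ) : Prop := Monotone b ∧ ∃ q : Polynomial ℕ, ∀ n, b n ≤ q.eval n

namespace PolyBdd

theorem const (c : ℕ) : PolyBdd fun _ => c :=
  ⟨monotone_const, Polynomial.C c, fun n => by simp⟩

theorem id : PolyBdd fun n => n :=
  ⟨monotone_id, Polynomial.X, fun n => by simp⟩

theorem add {a b : ℕ → ℕ} (ha : PolyBdd a) (hb : PolyBdd b) : PolyBdd fun n => a n + b n := by
  obtain ⟨hma, p, hp⟩ := ha
  obtain ⟨hmb, q, hq⟩ := hb
  exact ⟨hma.add hmb, p + q, fun n => by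
    rw [Polynomial.eval_add]; exact add_le_add (hp n) (hq n)⟩

theorem mul {a b : ℕ → ℕ} (ha : PolyBdd a) (hb : PolyBdd b) : PolyBdd fun n => a n * b n := by
  obtain ⟨hma, p, hp⟩ := ha
  obtain ⟨hmb, q, hq⟩ := hb
  exact ⟨fun m n h => Nat.mul_le_mul (hma h) (hmb h), p * q, fun n => by
    rw [Polynomial.eval_mul]; exact Nat.mul_le_mul (hp n) (hq n)⟩

theorem eval_mono (q : Polynomial ℕ) : Monotone fun n => q.eval n := by
  intro m n h
  simp only [Polynomial.eval_eq_sum, Polynomial.sum]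
  exact Finset.sum_le_sum fun i _ => Nat.mul_le_mul_left _ (Nat.pow_le_pow_left h i)

theorem comp {a b : ℕ → ℕ} (ha : PolyBdd a) (hb : PolyBdd b) : PolyBdd fun n => a (b n) := by
  obtain ⟨hma, p, hp⟩ := ha
  obtain ⟨hmb, q, hq⟩ := hb
  refine ⟨hma.comp hmb, p.comp q, fun n => ?_⟩
  rw [Polynomial.eval_comp]
  exact (hp _).trans (eval_mono p (hq n))

end PolyBdd

namespace Tree2

theorem one_le_size (t : Tree2) : 1 ≤ t.size := by cases t <;> simp [size]

theorem size_hd_le (t : Tree2) : t.hd.size ≤ t.size := by cases t <;> simp [size, hd]; omega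

theorem size_tl_le (t : Tree2) : t.tl.size ≤ t.size := by cases t <;> simp [size, tl]; omega

/-- Branch on whether a tree is `nil`. -/
def cond : Tree2 → Tree2 → Tree2 → Tree2
  | nil, _, c => c
  | cons _ _, b, _ => b

/-- Fold over a list, from left to right; the step function sees the remaining list. -/
def fold (g : Tree2 → Tree2 → Tree2) (a : Tree2) : Tree2 → Tree2
  | nil => a
  | cons e r => fold g (g a (cons e r)) r

/-- A tree as the list of its entries. -/
def toList : Tree2 → List Tree2
  | nil => []
  | cons a b => a :: b.toList

end Tree2

namespace WHILE

open Tree2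

/-- `c` replaces the value of the variable `k` by its image under `f`, leaves the variables below
`k` unchanged, and takes at most `b` steps, as a function of the size of the value. -/
def Computes (c : Cmd) (k : ℕ) (f : Tree2 → Tree2) (b : ℕ → ℕ) : Prop :=
  ∀ σ : Store, ∃ (σ' : Store) (t : ℕ), Exec c σ σ' t ∧ t ≤ b (σ k).size ∧ σ' k = f (σ k) ∧
    ∀ i < k, σ' i = σ i

/-- Functions that are computed in polynomial time and have outputs of polynomial size. -/
def PolyFun (f : Tree2 → Tree2) : Prop :=
  ∃ b : ℕ → ℕ, PolyBdd b ∧ (∀ x, (f x).size ≤ b x.size) ∧ ∀ k, ∃ c, Computes c k f b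

namespace PolyFun

theorem self : PolyFun fun x => x :=
  ⟨fun n => n, .id, fun _ => le_rfl, fun _ => ⟨Cmd.skip, fun σ =>
    ⟨σ, 1, .skip σ, one_le_size _, rfl, fun _ _ => rfl⟩⟩⟩

theorem comp {f g : Tree2 → Tree2} (hf : PolyFun f) (hg : PolyFun g) :
    PolyFun fun x => f (g x) := by
  obtain ⟨a, ha, has, hac⟩ := hf
  obtain ⟨b, hb, hbs, hbc⟩ := hg
  refine ⟨fun n => b n + a (b n), hb.add (ha.comp hb), fun x => ?_, fun k => ?_⟩
  · exact ((has _).trans (ha.1 (hbs x))).trans (Nat.le_add_left _ _)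
  · obtain ⟨c, hc⟩ := hac k
    obtain ⟨d, hd⟩ := hbc k
    refine ⟨.seq d c, fun σ => ?_⟩
    obtain ⟨σ', t, h1, h2, h3, h4⟩ := hd σ
    obtain ⟨σ'', u, k1, k2, k3, k4⟩ := hc σ'
    refine ⟨σ'', t + u, .seq h1 k1, ?_, by rw [k3, h3], fun i hi => by rw [k4 i hi, h4 i hi]⟩
    rw [h3] at k2
    exact add_le_add h2 (k2.trans (ha.1 (hbs _)))

theorem of_expr (F : Tree2 → Tree2) (e : ℕ → Expr) (m : ℕ)
    (he : ∀ k σ, (e k).eval σ = F (σ k)) (hcost : ∀ k, (e k).cost + 1 ≤ m)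
    (hs : ∀ x, (F x).size ≤ x.size) : PolyFun F :=
  ⟨fun n => n + m, .add .id (.const m), fun x => (hs x).trans (Nat.le_add_right _ _),
    fun k => ⟨.assign k (e k), fun σ => ⟨_, _, .assign k (e k) σ,
      (hcost k).trans (Nat.le_add_left _ _), by rw [Function.update_self, he],
      fun i hi => Function.update_of_ne hi.ne _ _⟩⟩⟩

theorem hd {f : Tree2 → Tree2} (hf : PolyFun f) : PolyFun fun x => (f x).hd :=
  comp (f := Tree2.hd) (of_expr _ (fun k => .hd (.var k)) 3 (fun _ _ => rfl) (fun _ => le_rfl)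
    size_hd_le) hf

theorem tl {f : Tree2 → Tree2} (hf : PolyFun f) : PolyFun fun x => (f x).tl :=
  comp (f := Tree2.tl) (of_expr _ (fun k => .tl (.var k)) 3 (fun _ _ => rfl) (fun _ => le_rfl)
    size_tl_le) hf

theorem nil : PolyFun fun _ => Tree2.nil :=
  of_expr _ (fun _ => .nil) 2 (fun _ _ => rfl) (fun _ => le_rfl) fun x => one_le_size x

theorem cons {f g : Tree2 → Tree2} (hf : PolyFun f) (hg : PolyFun g) :
    PolyFun fun x => Tree2.cons (f x) (g x) := by
  obtain ⟨a, ha, has, hac⟩ := hf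
  obtain ⟨b, hb, hbs, hbc⟩ := hg
  -- The three assignments cost 2 + 2 + 4 steps. The subprograms run on variables above k, so the
  -- input in k survives until the last one.
  refine ⟨fun n => a n + b n + 8, .add (ha.add hb) (.const 8), fun x => ?_, fun k => ?_⟩
  · have h1 := has x
    have h2 := hbs x
    simp only [size]
    omega
  · obtain ⟨c, hc⟩ := hac (k + 1)
    obtain ⟨d, hd⟩ := hbc (k + 2)
    refine ⟨.seq (.assign (k + 1) (.var k)) (.seq c (.seq (.assign (k + 2) (.var k))
      (.seq d (.assign k (.cons (.var (k + 1)) (.var (k + 2))))))), fun σ => ?_⟩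
    obtain ⟨σ₁, t, h1, h2, h3, h4⟩ := hc (Function.update σ (k + 1) (σ k))
    obtain ⟨σ₂, u, k1, k2, k3, k4⟩ := hd (Function.update σ₁ (k + 2) (σ₁ k))
    have e1 : σ₁ k = σ k := by
      rw [h4 k (by omega), Function.update_of_ne (by omega)]
    have e2 : σ₂ (k + 1) = f (σ k) := by
      rw [k4 _ (by omega), Function.update_of_ne (by omega), h3, Function.update_self]
    have e3 : σ₂ (k + 2) = g (σ k) := by
      rw [k3, Function.update_self, e1]
    refine ⟨_, _, .seq (.assign _ _ _) (.seq h1 (.seq (.assign _ _ _) (.seq k1 (.assign _ _ _)))),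
      ?_, ?_, fun i hi => ?_⟩
    · simp only [Function.update_self] at h2 k2
      rw [e1] at k2
      simp only [Expr.cost]
      omega
    · simp [Expr.eval, e2, e3]
    · rw [Function.update_of_ne (by omega), k4 i (by omega), Function.update_of_ne (by omega),
        h4 i (by omega), Function.update_of_ne (by omega)]

theorem cond {f g h : Tree2 → Tree2} (hf : PolyFun f) (hg : PolyFun g) (hh : PolyFun h) :
    PolyFun fun x => Tree2.cond (f x) (g x) (h x) := by
  obtain ⟨a, ha, has, hac⟩ := hf
  obtain ⟨b, hb, hbs, hbc⟩ := hg
  obtain ⟨e, he, hes, hec⟩ := hh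
  refine ⟨fun n => a n + b n + e n + 4, .add (.add (ha.add hb) he) (.const 4), fun x => ?_,
    fun k => ?_⟩
  · have h2 := hbs x
    have h3 := hes x
    rcases hfx : f x with _ | ⟨_, _⟩ <;> simp only [hfx, Tree2.cond] <;> omega
  · obtain ⟨c, hc⟩ := hac (k + 1)
    obtain ⟨d, hd⟩ := hbc k
    obtain ⟨d', hd'⟩ := hec k
    refine ⟨.seq (.assign (k + 1) (.var k)) (.seq c (.ite (.var (k + 1)) d d')), fun σ => ?_⟩
    obtain ⟨σ₁, t, h1, h2, h3, h4⟩ := hc (Function.update σ (k + 1) (σ k))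
    have e1 : ∀ i < k + 1, σ₁ i = σ i := fun i hi => by
      rw [h4 i hi, Function.update_of_ne (by omega)]
    have ek := e1 k (by omega)
    rw [Function.update_self] at h2 h3
    by_cases hn : f (σ k) = Tree2.nil
    · obtain ⟨σ₂, u, k1, k2, k3, k4⟩ := hd' σ₁
      refine ⟨_, _, .seq (.assign _ _ _) (.seq h1 (.ite_false (h3.trans hn) k1)), ?_, ?_,
        fun i hi => ?_⟩
      · rw [ek] at k2
        simp only [Expr.cost]
        omega
      · simp only [k3, ek, hn, Tree2.cond]
      · rw [k4 i hi, e1 i (by omega)]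
    · obtain ⟨σ₂, u, k1, k2, k3, k4⟩ := hd σ₁
      refine ⟨_, _, .seq (.assign _ _ _) (.seq h1 (.ite_true (fun h0 => hn (h3.symm.trans h0)) k1)),
        ?_, ?_, fun i hi => ?_⟩
      · rw [ek] at k2
        simp only [Expr.cost]
        omega
      · rw [k3, ek]
        rcases hfx : f (σ k) with _ | ⟨_, _⟩
        · exact absurd hfx hn
        · simp only [hfx, Tree2.cond]
      · rw [k4 i hi, e1 i (by omega)]

/-- The loop of a fold. -/
theorem exec_fold_loop {g : Tree2 → Tree2 → Tree2 → Tree2} {c : Cmd} {k : ℕ} {b : ℕ → ℕ}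
    (hb : Monotone b)
    (hc : Computes c (k + 3) (fun y => g y.hd y.tl.hd y.tl.tl) b) {x : Tree2} {B L : ℕ}
    {P : Tree2 → Tree2 → Prop} (hP : ∀ a e r, P a (Tree2.cons e r) → P (g a (Tree2.cons e r) x) r)
    (hB : ∀ a l, P a l → a.size ≤ B) (l : Tree2) : ∀ (a : Tree2) (σ : Store), σ k = x →
    σ (k + 1) = l → σ (k + 2) = a → P a l → l.size ≤ L → ∃ (σ' : Store) (t : ℕ),
      Exec (.while (.var (k + 1)) (.seq (.assign (k + 3) (.cons (.var (k + 2))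
        (.cons (.var (k + 1)) (.var k)))) (.seq c (.seq (.assign (k + 2) (.var (k + 3)))
          (.assign (k + 1) (.tl (.var (k + 1)))))))) σ σ' t ∧
      t ≤ l.size * (b (B + L + x.size + 2) + 16) ∧ σ' (k + 2) = fold (fun a s => g a s x) a l ∧
      ∀ i < k, σ' i = σ i := by
  induction l with
  | nil =>
    intro a σ hx hl ha _ _
    refine ⟨σ, _, .while_false hl, ?_, ha, fun _ _ => rfl⟩
    simp only [Expr.cost, size]
    omega
  | cons e r _ ih =>
    intro a σ hx hl ha hPa hL
    obtain ⟨σ₁, t, h1, h2, h3, h4⟩ := hc (Function.update σ (k + 3)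
      (Tree2.cons a (Tree2.cons (Tree2.cons e r) x)))
    have e1 : ∀ i < k + 3, σ₁ i = σ i := fun i hi => by
      rw [h4 i hi, Function.update_of_ne (by omega)]
    rw [Function.update_self] at h2 h3
    simp only [Tree2.hd, Tree2.tl] at h3
    simp only [size] at hL
    obtain ⟨σ₂, u, k1, k2, k3, k4⟩ := ih (g a (Tree2.cons e r) x)
      (Function.update (Function.update σ₁ (k + 2) (σ₁ (k + 3))) (k + 1) r)
      (by rw [Function.update_of_ne (by omega), Function.update_of_ne (by omega),
        e1 k (by omega), hx])
      (by rw [Function.update_self])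
      (by rw [Function.update_of_ne (by omega), Function.update_self, h3])
      (hP _ _ _ hPa) (by omega)
    have ex1 : Exec (.assign (k + 3) (.cons (.var (k + 2)) (.cons (.var (k + 1)) (.var k)))) σ
        (Function.update σ (k + 3) (Tree2.cons a (Tree2.cons (Tree2.cons e r) x))) 6 := by
      have := Exec.assign (k + 3) (.cons (.var (k + 2)) (.cons (.var (k + 1)) (.var k))) σ
      simpa only [Expr.eval, Expr.cost, hx, hl, ha] using this
    have ex2 : Exec (.assign (k + 1) (.tl (.var (k + 1))))
        (Function.update σ₁ (k + 2) (σ₁ (k + 3)))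
        (Function.update (Function.update σ₁ (k + 2) (σ₁ (k + 3))) (k + 1) r) 3 := by
      have := Exec.assign (k + 1) (.tl (.var (k + 1))) (Function.update σ₁ (k + 2) (σ₁ (k + 3)))
      simpa only [Expr.eval, Expr.cost, Function.update_of_ne (show k + 1 ≠ k + 2 by omega),
        e1 (k + 1) (by omega), hl, Tree2.tl] using this
    refine ⟨σ₂, _, .while_true (by simp [Expr.eval, hl])
      (.seq ex1 (.seq h1 (.seq (.assign _ _ _) ex2))) k1, ?_, k3, fun i hi => ?_⟩
    -- The step command receives the accumulator, the remaining list and the input packed into one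
    -- tree; the 2 counts the two extra nodes.
    · have hle : (Tree2.cons a (Tree2.cons (Tree2.cons e r) x)).size ≤ B + L + x.size + 2 := by
        have := hB _ _ hPa
        simp only [size]
        omega
      have h2' := h2.trans (hb hle)
      simp only [Expr.cost, size]
      have : (e.size + r.size + 1) * (b (B + L + x.size + 2) + 16)
        ≥ r.size * (b (B + L + x.size + 2) + 16) + (b (B + L + x.size + 2) + 16) := by
        nlinarith [Nat.zero_le (e.size * (b (B + L + x.size + 2) + 16))]
      omega
    · rw [k4 i hi, Function.update_of_ne (by omega), Function.update_of_ne (by omega),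
        e1 i (by omega)]

/-- Iterating a polynomial-size step may produce exponential size. The invariant P, relating
accumulator and remaining list, excludes this by bounding every intermediate accumulator by B. -/
theorem fold {f h : Tree2 → Tree2} {g : Tree2 → Tree2 → Tree2 → Tree2} (hf : PolyFun f)
    (hh : PolyFun h) (hg : PolyFun fun y => g y.hd y.tl.hd y.tl.tl) {B : ℕ → ℕ} (hB : PolyBdd B)
    (P : Tree2 → Tree2 → Tree2 → Prop) (h0 : ∀ x, P x (f x) (h x))
    (hP : ∀ x a e r, P x a (Tree2.cons e r) → P x (g a (Tree2.cons e r) x) r)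
    (hPB : ∀ x a l, P x a l → a.size ≤ B x.size) :
    PolyFun fun x => Tree2.fold (fun a s => g a s x) (f x) (h x) := by
  obtain ⟨bf, hbf, hfs, hfc⟩ := hf
  obtain ⟨bh, hbh, hhs, hhc⟩ := hh
  obtain ⟨bg, hbg, hgs, hgc⟩ := hg
  refine ⟨fun n => B n + (bf n + bh n + bh n * (bg (B n + bh n + n + 2) + 16) + 6), ?_, fun x => ?_,
    fun k => ?_⟩
  · exact hB.add ((hbf.add hbh).add (hbh.mul ((hbg.comp (((hB.add hbh).add .id).add
      (.const 2))).add (.const 16))) |>.add (.const 6))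
  · have key : ∀ l a, P x a l → (Tree2.fold (fun a s => g a s x) a l).size ≤ B x.size := by
      intro l
      induction l with
      | nil => intro a ha; exact hPB _ _ _ ha
      | cons e r _ ih => intro a ha; exact ih _ (hP _ _ _ _ ha)
    exact (key _ _ (h0 x)).trans (Nat.le_add_right _ _)
  · obtain ⟨cf, hcf⟩ := hfc (k + 2)
    obtain ⟨ch, hch⟩ := hhc (k + 1)
    obtain ⟨cg, hcg⟩ := hgc (k + 3)
    refine ⟨.seq (.assign (k + 1) (.var k)) (.seq ch (.seq (.assign (k + 2) (.var k)) (.seq cf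
      (.seq (.while (.var (k + 1)) (.seq (.assign (k + 3) (.cons (.var (k + 2))
        (.cons (.var (k + 1)) (.var k)))) (.seq cg (.seq (.assign (k + 2) (.var (k + 3)))
          (.assign (k + 1) (.tl (.var (k + 1)))))))) (.assign k (.var (k + 2))))))), fun σ => ?_⟩
    obtain ⟨σ₁, t, h1, h2, h3, h4⟩ := hch (Function.update σ (k + 1) (σ k))
    obtain ⟨σ₂, u, k1, k2, k3, k4⟩ := hcf (Function.update σ₁ (k + 2) (σ₁ k))
    have e1 : ∀ i < k + 1, σ₁ i = σ i := fun i hi => by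
      rw [h4 i hi, Function.update_of_ne (by omega)]
    have e2 : ∀ i < k + 2, σ₂ i = σ₁ i := fun i hi => by
      rw [k4 i hi, Function.update_of_ne (by omega)]
    have e1k := e1 k (by omega)
    rw [Function.update_self] at h2 h3 k2 k3
    rw [e1k] at k2 k3
    obtain ⟨σ₃, v, l1, l2, l3, l4⟩ := exec_fold_loop hbg.1 hcg (hP (σ k)) (hPB (σ k)) (h (σ k))
      (f (σ k)) σ₂ (by rw [e2 k (by omega), e1k]) (by rw [e2 _ (by omega), h3]) k3 (h0 _) (hhs _)
    refine ⟨_, _, .seq (.assign _ _ _) (.seq h1 (.seq (.assign _ _ _) (.seq k1 (.seq l1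
      (.assign _ _ _))))), ?_, ?_, fun i hi => ?_⟩
    · have l2' := l2.trans (Nat.mul_le_mul_right _ (hhs (σ k)))
      simp only [Expr.cost]
      omega
    · simp [Expr.eval, l3]
    · rw [Function.update_of_ne (by omega), l4 i hi, e2 i (by omega), e1 i (by omega)]

/-- Folds whose accumulator grows by a bounded amount in each step. -/
theorem fold_of_size_le {f h : Tree2 → Tree2} {g : Tree2 → Tree2 → Tree2 → Tree2} (hf : PolyFun f)
    (hh : PolyFun h) (hg : PolyFun fun y => g y.hd y.tl.hd y.tl.tl) {r : ℕ → ℕ} (hr : PolyBdd r)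
    (hs : ∀ a l x, l.size ≤ (h x).size → (g a l x).size ≤ a.size + r x.size) :
    PolyFun fun x => Tree2.fold (fun a s => g a s x) (f x) (h x) := by
  have ⟨bf, hbf, hfs, _⟩ := hf
  have ⟨bh, hbh, hhs, _⟩ := hh
  -- Invariant: the size of the accumulator plus the growth still allowed for the remaining list
  -- never exceeds its initial value.
  refine fold hf hh hg (hbf.add (hbh.mul hr)) (fun x a l => l.size ≤ (h x).size ∧
    a.size + l.size * r x.size ≤ (f x).size + (h x).size * r x.size)
    (fun x => ⟨le_rfl, le_rfl⟩) ?_ ?_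
  · rintro x a e l ⟨h1, h2⟩
    have h3 := hs a _ x h1
    simp only [size] at h1 h2
    refine ⟨by omega, ?_⟩
    nlinarith [Nat.zero_le (e.size * r x.size)]
  · rintro x a l ⟨_, h2⟩
    have := hfs x
    have := Nat.mul_le_mul_right (r x.size) (hhs x)
    exact le_trans (Nat.le_add_right _ _) (h2.trans (by omega))

end PolyFun

theorem PolyFun.polyTimeDecidable {α : Type*} {enc : α → Tree2} {P : α → Prop} {f : Tree2 → Tree2}
    (hf : PolyFun f) (h : ∀ a, f (enc a) ≠ Tree2.nil ↔ P a) : PolyTimeDecidable enc P := by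
  obtain ⟨b, ⟨_, q, hq⟩, _, hc⟩ := hf
  obtain ⟨c, hc⟩ := hc 0
  refine ⟨c, q, fun a => ?_⟩
  obtain ⟨σ, t, h1, h2, h3, -⟩ := hc (initStore (enc a))
  refine ⟨σ, t, h1, h2.trans (hq _), ?_⟩
  rw [h3]
  exact h a

end WHILE

/-! ### Lists, unary indices and binary numbers as trees -/

namespace Tree2

theorem hd_cons (a b : Tree2) : (cons a b).hd = a := rfl

theorem tl_cons (a b : Tree2) : (cons a b).tl = b := rfl

theorem toList_encList {α : Type*} (enc : α → Tree2) (l : List α) :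
    (encList enc l).toList = l.map enc := by
  induction l with
  | nil => rfl
  | cons a l ih => simp [encList, toList, ih]

/-- Normalize a tree to the encoding of a Boolean. -/
def toBool (t : Tree2) : Tree2 := cond t (cons nil nil) nil

def not (t : Tree2) : Tree2 := cond t nil (cons nil nil)

def and (a b : Tree2) : Tree2 := cond a b nil

def or (a b : Tree2) : Tree2 := cond a (cons nil nil) b

@[simp] theorem toBool_ne_nil {t : Tree2} : toBool t ≠ nil ↔ t ≠ nil := by
  cases t <;> simp [toBool, cond]

@[simp] theorem not_ne_nil {t : Tree2} : not t ≠ nil ↔ t = nil := by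
  cases t <;> simp [not, cond]

@[simp] theorem and_ne_nil {a b : Tree2} : and a b ≠ nil ↔ a ≠ nil ∧ b ≠ nil := by
  cases a <;> simp [and, cond]

@[simp] theorem or_ne_nil {a b : Tree2} : or a b ≠ nil ↔ a ≠ nil ∨ b ≠ nil := by
  cases a <;> simp [or, cond]

/-- The suffix of a list from the position given by the length of another list. -/
def drop (l i : Tree2) : Tree2 := fold (fun a _ => a.tl) l i

/-- The entry of a list at the position given by the length of another list. -/
def nth (l i : Tree2) : Tree2 := (drop l i).hd

/-- Some entry of a list satisfies a test. -/
def any (g : Tree2 → Tree2) (l : Tree2) : Tree2 :=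
  fold (fun a s => cond a a (toBool (g s.hd))) nil l

/-- The images of the entries of a list, in reverse order. -/
def mapRev (g : Tree2 → Tree2) (l : Tree2) : Tree2 := fold (fun a s => cons (g s.hd) a) nil l

def map (g : Tree2 → Tree2) (l : Tree2) : Tree2 := mapRev (fun e => e) (mapRev g l)

/-- Iterate a function as often as given by the length of a list. -/
def iterate (g : Tree2 → Tree2) (a l : Tree2) : Tree2 := fold (fun a _ => g a) a l

/-- For a list of length `n`, a list of lists of lengths `0, …, n - 1`. -/
def indices (l : Tree2) : Tree2 := fold (fun a s => cons s.tl a) nil l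

/-- Compare the lengths of two lists. -/
def eqLength (a b : Tree2) : Tree2 := and (not (drop a b)) (not (drop b a))

theorem toList_tl (l : Tree2) : l.tl.toList = l.toList.tail := by
  cases l <;> rfl

theorem toList_ne_nil {l : Tree2} : l ≠ nil ↔ l.toList ≠ [] := by
  cases l <;> simp [toList]

theorem iterate_eq (g : Tree2 → Tree2) (a l : Tree2) :
    iterate g a l = g^[l.toList.length] a := by
  induction l generalizing a with
  | nil => rfl
  | cons e r _ ih => exact ih (g a)

theorem toList_drop (l i : Tree2) : (drop l i).toList = l.toList.drop i.toList.length := by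
  induction i generalizing l with
  | nil => rfl
  | cons e r _ ih =>
    refine (ih l.tl).trans ?_
    simp [toList_tl, toList]

theorem nth_eq (l i : Tree2) : nth l i = l.toList.getD i.toList.length nil := by
  have h := toList_drop l i
  rw [nth]
  rw [List.getD_eq_getElem?_getD, ← Nat.add_zero i.toList.length, ← List.getElem?_drop, ← h]
  cases drop l i <;> simp [hd, toList]

theorem any_ne_nil {g : Tree2 → Tree2} {l : Tree2} : any g l ≠ nil ↔ ∃ e ∈ l.toList, g e ≠ nil := by
  have key : ∀ a, fold (fun a s => cond a a (toBool (g s.hd))) a l ≠ nil ↔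
      a ≠ nil ∨ ∃ e ∈ l.toList, g e ≠ nil := by
    induction l with
    | nil => intro a; simp [fold, toList]
    | cons e r _ ih =>
      intro a
      rw [fold, ih]
      cases a <;> simp [cond, toList, hd, toBool_ne_nil]
  rw [any, key]
  simp

theorem toList_mapRev (g : Tree2 → Tree2) (l : Tree2) :
    (mapRev g l).toList = (l.toList.map g).reverse := by
  have key : ∀ a, (fold (fun a s => cons (g s.hd) a) a l).toList
      = (l.toList.map g).reverse ++ a.toList := by
    induction l with
    | nil => intro a; simp [fold, toList]
    | cons e r _ ih => intro a; rw [fold, ih]; simp [toList, hd]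
  rw [mapRev, key]
  simp [toList]

theorem toList_map (g : Tree2 → Tree2) (l : Tree2) : (map g l).toList = l.toList.map g := by
  simp [map, toList_mapRev]

theorem toList_indices (l : Tree2) :
    (indices l).toList.map (fun e => e.toList.length) = List.range l.toList.length := by
  have key : ∀ a, (fold (fun a s => cons s.tl a) a l).toList.map (fun e => e.toList.length)
      = List.range l.toList.length ++ a.toList.map (fun e => e.toList.length) := by
    induction l with
    | nil => intro a; simp [fold, toList]
    | cons e r _ ih =>
      intro a
      rw [fold, ih]
      simp [toList, tl, List.range_succ]
  rw [indices, key]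
  simp [toList]

theorem eqLength_ne_nil {a b : Tree2} :
    eqLength a b ≠ nil ↔ a.toList.length = b.toList.length := by
  have h : ∀ a b, drop a b = nil ↔ a.toList.length ≤ b.toList.length := by
    intro a b
    rw [← not_iff_not, ← ne_eq, toList_ne_nil, toList_drop]
    simp
  rw [eqLength, and_ne_nil, not_ne_nil, not_ne_nil, h, h]
  omega

/-- Comparison of binary numbers: the first component of the accumulator is the comparison of the
digits read so far. -/
def leStep (a s : Tree2) : Tree2 :=
  cons (cond s.hd (cond a.tl.hd a.hd nil) (cond a.tl.hd (cons nil nil) a.hd)) a.tl.tl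

/-- Comparison of binary numbers. -/
def natLe (a b : Tree2) : Tree2 :=
  or (fold leStep (cons (cons nil nil) b) a).tl (fold leStep (cons (cons nil nil) b) a).hd

theorem encNat_zero : encNat 0 = nil := by simp [encNat, encList]

theorem encNat_of_ne_zero {n : ℕ} (hn : n ≠ 0) :
    encNat n = cons (encBool (decide (n % 2 = 1))) (encNat (n / 2)) := by
  rcases Nat.even_or_odd' n with ⟨m, rfl | rfl⟩
  · rw [encNat, Nat.bit0_bits m (by omega)]
    simp [encNat, encList]
  · rw [encNat, Nat.bit1_bits m]
    have : (2 * m + 1) / 2 = m := by omega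
    simp [encNat, encList, this]

theorem encNat_ne_nil {n : ℕ} : encNat n ≠ nil ↔ n ≠ 0 := by
  by_cases hn : n = 0
  · simp [hn, encNat_zero]
  · simp [hn, encNat_of_ne_zero hn]

theorem hd_encNat_ne_nil {n : ℕ} : (encNat n).hd ≠ nil ↔ n % 2 = 1 := by
  by_cases hn : n = 0
  · simp [hn, encNat_zero, hd]
  · rw [encNat_of_ne_zero hn]
    by_cases h : n % 2 = 1 <;> simp [hd, h, encBool]

theorem tl_encNat (n : ℕ) : (encNat n).tl = encNat (n / 2) := by
  by_cases hn : n = 0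
  · simp [hn, encNat_zero, tl]
  · rw [encNat_of_ne_zero hn, tl]

theorem cond_ne_nil {a b c : Tree2} :
    cond a b c ≠ nil ↔ (a ≠ nil ∧ b ≠ nil) ∨ (a = nil ∧ c ≠ nil) := by
  cases a <;> simp [cond]

/-- Digits come least significant first, so a later difference overrides the verdict c on the lower
digits, and equal digits keep it. Missing digits of m read as 0. When n is exhausted, a non-nil rest
of m is non-zero and decides n < m. -/
theorem fold_leStep (n m : ℕ) (c : Tree2) :
    ((fold leStep (cons c (encNat m)) (encNat n)).tl ≠ nil ∨
      (fold leStep (cons c (encNat m)) (encNat n)).hd ≠ nil) ↔ n < m ∨ (n = m ∧ c ≠ nil) := by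
  induction n using Nat.strong_induction_on generalizing m c with
  | _ n ih =>
    by_cases hn : n = 0
    · subst hn
      rw [encNat_zero, fold, tl, hd, encNat_ne_nil]
      by_cases hc : c = nil <;> simp [hc]
      omega
    · rw [encNat_of_ne_zero hn, fold, leStep]
      simp only [hd_cons, tl_cons, tl_encNat]
      rw [ih _ (by omega), cond_ne_nil, cond_ne_nil, cond_ne_nil, ← not_ne_iff (b := nil),
        ← not_ne_iff (b := nil), hd_encNat_ne_nil]
      have hb : encBool (decide (n % 2 = 1)) ≠ nil ↔ n % 2 = 1 := by
        by_cases h : n % 2 = 1 <;> simp [h, encBool]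
      rw [hb]
      by_cases hc : c = nil <;> simp [hc] <;> omega

theorem natLe_ne_nil {n m : ℕ} : natLe (encNat n) (encNat m) ≠ nil ↔ n ≤ m := by
  rw [natLe, or_ne_nil, fold_leStep]
  simp
  omega

end Tree2

/-! ### Polynomial time of the list and number operations -/

namespace WHILE.PolyFun

open Tree2

variable {f g h : Tree2 → Tree2}

theorem toBool (hf : PolyFun f) : PolyFun fun x => (f x).toBool :=
  hf.cond (nil.cons nil) nil

theorem not (hf : PolyFun f) : PolyFun fun x => (f x).not :=
  hf.cond nil (nil.cons nil)

theorem and (hf : PolyFun f) (hg : PolyFun g) : PolyFun fun x => (f x).and (g x) :=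
  hf.cond hg nil

theorem or (hf : PolyFun f) (hg : PolyFun g) : PolyFun fun x => (f x).or (g x) :=
  hf.cond (nil.cons nil) hg

theorem drop (hf : PolyFun f) (hg : PolyFun g) : PolyFun fun x => (f x).drop (g x) :=
  fold_of_size_le (g := fun a _ _ => a.tl) hf hg self.hd.tl (.const 0)
    fun a _ _ _ => (size_tl_le a).trans (Nat.le_add_right _ _)

theorem nth (hf : PolyFun f) (hg : PolyFun g) : PolyFun fun x => (f x).nth (g x) :=
  (hf.drop hg).hd

theorem eqLength (hf : PolyFun f) (hg : PolyFun g) : PolyFun fun x => (f x).eqLength (g x) :=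
  (hf.drop hg).not.and (hg.drop hf).not

theorem indices (hf : PolyFun f) : PolyFun fun x => (f x).indices := by
  have ⟨b, hb, hbs, _⟩ := hf
  refine fold_of_size_le (g := fun a s _ => Tree2.cons s.tl a) nil hf (.cons self.tl.hd.tl self.hd)
    (hb.add (.const 1)) fun a l x hl => ?_
  have := size_tl_le l
  have := hbs x
  simp only [size]
  omega

theorem any {g : Tree2 → Tree2 → Tree2} (hf : PolyFun f) (hg : PolyFun fun y => g y.hd y.tl) :
    PolyFun fun x => (f x).any fun e => g e x := by
  -- Normalizing by `toBool` keeps the accumulator at size at most 3, whatever the test returns.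
  refine fold_of_size_le (g := fun a s x => Tree2.cond a a (Tree2.toBool (g s.hd x))) nil hf
    (self.hd.cond self.hd ?_) (.const 3) fun a l x _ => ?_
  · exact (hg.comp (self.tl.hd.hd.cons self.tl.tl)).toBool
  · cases a with
    | cons => simp [Tree2.cond]
    | nil => cases g l.hd x <;> simp [Tree2.cond, Tree2.toBool, size]

theorem mapRev {g : Tree2 → Tree2 → Tree2} (hf : PolyFun f) (hg : PolyFun fun y => g y.hd y.tl) :
    PolyFun fun x => (f x).mapRev fun e => g e x := by
  have ⟨b, hb, hbs, _⟩ := hf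
  have ⟨r, hr, hrs, _⟩ := hg
  refine fold_of_size_le (g := fun a s x => Tree2.cons (g s.hd x) a) nil hf
    (.cons (hg.comp (self.tl.hd.hd.cons self.tl.tl)) self.hd)
    (.add (hr.comp ((hb.add .id).add (.const 1))) (.const 1)) fun a l x hl => ?_
  have h1 := hrs (Tree2.cons l.hd x)
  have h2 : (Tree2.cons l.hd x).size ≤ b x.size + x.size + 1 := by
    have := size_hd_le l
    have := hbs x
    simp only [size]
    omega
  have h3 : (g l.hd x).size ≤ r (b x.size + x.size + 1) := h1.trans (hr.1 h2)
  simp only [size]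
  omega

theorem map {g : Tree2 → Tree2 → Tree2} (hf : PolyFun f) (hg : PolyFun fun y => g y.hd y.tl) :
    PolyFun fun x => (f x).map fun e => g e x :=
  mapRev (g := fun e _ => e) (mapRev hf hg) self.hd

/-- Iteration of a function with bounded output. -/
theorem iterate {g : Tree2 → Tree2 → Tree2} (hf : PolyFun f) (hh : PolyFun h)
    (hg : PolyFun fun y => g y.hd y.tl) {r : ℕ → ℕ} (hr : PolyBdd r)
    (hs : ∀ a x, (g a x).size ≤ r x.size) :
    PolyFun fun x => Tree2.iterate (fun a => g a x) (f x) (h x) :=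
  fold_of_size_le (g := fun a _ x => g a x) hf hh (hg.comp (self.hd.cons self.tl.tl)) hr
    fun a _ x _ => (hs a x).trans (Nat.le_add_left _ _)

theorem natLe (hf : PolyFun f) (hg : PolyFun g) : PolyFun fun x => (f x).natLe (g x) := by
  have key : PolyFun fun x => Tree2.fold leStep (Tree2.cons (Tree2.cons Tree2.nil Tree2.nil) (g x))
      (f x) := by
    refine fold_of_size_le (g := fun a s _ => leStep a s) ((nil.cons nil).cons hg) hf ?_ (.const 4)
      fun a l x _ => ?_
    · exact .cons (.cond self.tl.hd.hd (.cond self.hd.tl.hd self.hd.hd nil)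
        (.cond self.hd.tl.hd (nil.cons nil) self.hd.hd)) self.hd.tl.tl
    · have h1 : ∀ t, (Tree2.cond l.hd (Tree2.cond t a.hd Tree2.nil)
          (Tree2.cond t (Tree2.cons Tree2.nil Tree2.nil) a.hd)).size ≤ a.hd.size + 2 := by
        intro t
        have := one_le_size a.hd
        cases l.hd <;> cases t <;> simp only [Tree2.cond, size] <;> omega
      have h2 := h1 a.tl.hd
      have h3 := size_tl_le a.tl
      simp only [leStep, size]
      cases a with
      | nil => simp only [Tree2.hd, Tree2.tl, size] at *; omega
      | cons u v => simp only [Tree2.hd, Tree2.tl, size] at *; omega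
  exact key.tl.or key.hd

end WHILE.PolyFun

/-! ### Maximal end-components as iterated fixpoints -/

/-- If the n-th iterate is not fixed, neither is any earlier one, so the rank has increased n + 1
times and exceeds its bound n. -/
theorem iterate_fixed_of_rank {α : Type*} (f : α → α) (a : α) (rank : α → ℕ) (n : ℕ)
    (hn : ∀ x, rank x ≤ n)
    (h : ∀ i, f (f^[i] a) ≠ f^[i] a → rank (f^[i] a) < rank (f (f^[i] a))) :
    f (f^[n] a) = f^[n] a := by
  by_contra hne
  have key : ∀ i ≤ n, f (f^[i] a) ≠ f^[i] a := by
    intro i hi heq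
    obtain ⟨k, rfl⟩ := Nat.exists_eq_add_of_le' hi
    rw [Function.iterate_add_apply, Function.iterate_fixed heq] at hne
    exact hne heq
  have hr : ∀ i ≤ n + 1, i ≤ rank (f^[i] a) := by
    intro i
    induction i with
    | zero => simp
    | succ i ih =>
      intro hi
      have := h i (key i (by omega))
      rw [Function.iterate_succ_apply']
      have := ih (by omega)
      omega
  have := hr (n + 1) le_rfl
  have := hn (f^[n + 1] a)
  omega

theorem iterate_le_iterate_succ {α : Type*} [Preorder α] {f : α → α} (hf : Monotone f) {a : α}
    (h : a ≤ f a) (i : ℕ) : f^[i] a ≤ f (f^[i] a) := by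
  rw [← Function.iterate_succ_apply' f]
  exact hf.monotone_iterate_of_le_map h (Nat.le_succ i)

theorem iterate_succ_le_iterate {α : Type*} [Preorder α] {f : α → α} (hf : Monotone f) {a : α}
    (h : f a ≤ a) (i : ℕ) : f (f^[i] a) ≤ f^[i] a := by
  rw [← Function.iterate_succ_apply' f]
  exact hf.antitone_iterate_of_map_le h (Nat.le_succ i)

section

variable {n : ℕ}

theorem Set.ncard_le_of_fin (A : Set (Fin n)) : A.ncard ≤ n := by
  simpa using Set.ncard_le_card A

theorem iterate_fixed_of_le {f : Set (Fin n) → Set (Fin n)} (hf : Monotone f) {A : Set (Fin n)}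
    (h : A ⊆ f A) : f (f^[n] A) = f^[n] A := by
  refine iterate_fixed_of_rank f A Set.ncard n Set.ncard_le_of_fin fun i hi => ?_
  exact Set.ncard_lt_ncard (lt_of_le_of_ne (iterate_le_iterate_succ hf h i) (Ne.symm hi))
    (Set.toFinite _)

theorem iterate_fixed_of_ge {f : Set (Fin n) → Set (Fin n)} (hf : Monotone f) {A : Set (Fin n)}
    (h : f A ⊆ A) : f (f^[n] A) = f^[n] A := by
  refine iterate_fixed_of_rank f A (fun B => n - B.ncard) n (fun _ => Nat.sub_le _ _)
    fun i hi => ?_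
  have h1 := Set.ncard_lt_ncard (lt_of_le_of_ne (iterate_succ_le_iterate hf h i) hi)
    (Set.toFinite _)
  have h2 := Set.ncard_le_of_fin (f^[i] A)
  omega

/-- One step of forward exploration from `a` inside `Z`. -/
def reachStep (E : Fin n → Fin n → Prop) (Z : Set (Fin n)) (a : Fin n) (R : Set (Fin n)) :
    Set (Fin n) := {t | t ∈ Z ∧ (t = a ∨ ∃ r, r ∈ R ∧ E r t)}

/-- `b` is reachable from `a` inside `Z`. -/
def ReachIn (E : Fin n → Fin n → Prop) (Z : Set (Fin n)) (a b : Fin n) : Prop :=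
  a ∈ Z ∧ Relation.ReflTransGen (fun p q => p ∈ Z ∧ q ∈ Z ∧ E p q) a b

theorem ReachIn.mono {E : Fin n → Fin n → Prop} {Z Z' : Set (Fin n)} (h : Z ⊆ Z') {a b : Fin n}
    (hr : ReachIn E Z a b) : ReachIn E Z' a b :=
  ⟨h hr.1, hr.2.lift id fun _ _ hpq => ⟨h hpq.1, h hpq.2.1, hpq.2.2⟩⟩

theorem mem_iterate_reachStep {E : Fin n → Fin n → Prop} {Z : Set (Fin n)} {a t : Fin n} :
    t ∈ (reachStep E Z a)^[n] ∅ ↔ ReachIn E Z a t := by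
  have hmono : Monotone (reachStep E Z a) := fun R R' h t ht =>
    ⟨ht.1, ht.2.imp_right fun ⟨r, hr, hrt⟩ => ⟨r, h hr, hrt⟩⟩
  constructor
  · have key : ∀ i, ∀ t ∈ (reachStep E Z a)^[i] ∅, t ∈ Z ∧ ReachIn E Z a t := by
      intro i
      induction i with
      | zero => intro t ht; exact absurd ht (Set.notMem_empty t)
      | succ i ih =>
        intro t ht
        rw [Function.iterate_succ_apply'] at ht
        obtain ⟨hZ, rfl | ⟨r, hr, hrt⟩⟩ := ht
        · exact ⟨hZ, hZ, .refl⟩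
        · obtain ⟨hrZ, ha, hp⟩ := ih r hr
          exact ⟨hZ, ha, hp.tail ⟨hrZ, hZ, hrt⟩⟩
    exact fun ht => (key n t ht).2
  · rintro ⟨ha, hp⟩
    have hfix := iterate_fixed_of_le hmono (Set.empty_subset (reachStep E Z a ∅))
    induction hp with
    | refl => rw [← hfix]; exact ⟨ha, .inl rfl⟩
    | tail _ hbc ih => rw [← hfix]; exact ⟨hbc.2.1, .inr ⟨_, ih, hbc.2.2⟩⟩

/-- Remove the states that violate one of the conditions on an end-component containing `u`. -/
def ecStep (M : MDP (Fin n)) (u : Fin n) (Z : Set (Fin n)) : Set (Fin n) :=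
  {s | s ∈ Z ∧ ((s ∈ M.S1 ∧ ∃ t, M.E s t ∧ t ∈ Z) ∨ (s ∉ M.S1 ∧ ¬ ∃ t, M.E s t ∧ t ∉ Z)) ∧
    ReachIn M.E Z u s ∧ ReachIn M.E Z s u}

theorem ecStep_mono (M : MDP (Fin n)) (u : Fin n) : Monotone (ecStep M u) := by
  rintro Z Z' h s ⟨h1, h2, h3, h4⟩
  refine ⟨h h1, ?_, h3.mono h, h4.mono h⟩
  rcases h2 with ⟨hs, t, hst, ht⟩ | ⟨hs, ht⟩
  · exact .inl ⟨hs, t, hst, h ht⟩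
  · exact .inr ⟨hs, fun ⟨t, hst, htZ⟩ => ht ⟨t, hst, fun h' => htZ (h h')⟩⟩

/-- A fixpoint of `ecStep` containing u is an end-component. Conversely, an end-component through u
inside X is contained in its own image, so by monotonicity it survives every round. -/
theorem mem_iterate_ecStep {M : MDP (Fin n)} {u v : Fin n} {X : Set (Fin n)} :
    (u ∈ (ecStep M u)^[n] X ∧ v ∈ (ecStep M u)^[n] X) ↔
      ∃ D : Finset (Fin n), M.IsEC D ∧ (D : Set (Fin n)) ⊆ X ∧ u ∈ D ∧ v ∈ D := by
  classical
  constructor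
  · rintro ⟨hu, hv⟩
    have hdec : ecStep M u X ⊆ X := fun s hs => hs.1
    have hfix := iterate_fixed_of_ge (ecStep_mono M u) hdec
    have hsub : (ecStep M u)^[n] X ⊆ X :=
      (ecStep_mono M u).antitone_iterate_of_map_le hdec (Nat.zero_le n)
    set Z := (ecStep M u)^[n] X
    have hm : ∀ s, s ∈ Z.toFinite.toFinset ↔ s ∈ Z := fun s => by simp
    have hZ : ∀ s ∈ Z, s ∈ ecStep M u Z := fun s hs => by rwa [hfix]
    refine ⟨Z.toFinite.toFinset, ⟨⟨u, (hm u).2 hu⟩, ?_, ?_, ?_⟩, by simpa using hsub,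
      (hm u).2 hu, (hm v).2 hv⟩
    · intro s hs h1 t hst
      obtain ⟨-, ⟨h, -⟩ | ⟨-, h⟩, -⟩ := hZ s ((hm s).1 hs)
      · exact absurd h h1
      · by_contra ht
        exact h ⟨t, hst, fun h' => ht ((hm t).2 h')⟩
    · intro s hs h1
      obtain ⟨-, ⟨-, t, hst, ht⟩ | ⟨h, -⟩, -⟩ := hZ s ((hm s).1 hs)
      · exact ⟨t, (hm t).2 ht, hst⟩
      · exact absurd h1 h
    · intro s hs t ht
      simp only [hm] at *
      -- Any two states are connected through u.
      exact (hZ s hs).2.2.2.2.trans (hZ t ht).2.2.1.2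
  · rintro ⟨D, hD, hDX, hu, hv⟩
    have hstep : (D : Set (Fin n)) ⊆ ecStep M u D := by
      intro s hs
      refine ⟨hs, ?_, ⟨hu, hD.connected u hu s hs⟩, ⟨hs, hD.connected s hs u hu⟩⟩
      by_cases h1 : s ∈ M.S1
      · obtain ⟨t, ht, hst⟩ := hD.stay s hs h1
        exact .inl ⟨h1, t, hst, ht⟩
      · exact .inr ⟨h1, fun ⟨t, hst, ht⟩ => ht (hD.closed s hs h1 t hst)⟩
    have hsub : (D : Set (Fin n)) ⊆ (ecStep M u)^[n] X :=
      ((ecStep_mono M u).monotone_iterate_of_le_map hstep (Nat.zero_le n)).trans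
        ((ecStep_mono M u).iterate n hDX)
    exact ⟨hsub hu, hsub hv⟩

/-- The states of `C` whose priorities are bounded by those of `u` and of `v`. -/
def candidates (C : Finset (Fin n)) (p1 p2 : Fin n → ℕ) (u v : Fin n) : Set (Fin n) :=
  {s | s ∈ C ∧ p1 s ≤ p1 u ∧ p2 s ≤ p2 v}

/-- Take u and v to be maximizers of p1 and p2 on D. Conversely, the bounds defining `candidates`
make u and v maximal in any D found. Evenness appears as a negated test of the lowest bit, as the
program performs it. -/
theorem exists_isEC_maxEven_iff {M : MDP (Fin n)} {C : Finset (Fin n)} {p1 p2 : Fin n → ℕ} :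
    (∃ D : Finset (Fin n), M.IsEC D ∧ D ⊆ C ∧ (maxEven D p1).Nonempty ∧ (maxEven D p2).Nonempty) ↔
      ∃ u v, ¬ p1 u % 2 = 1 ∧ ¬ p2 v % 2 = 1 ∧
        u ∈ (ecStep M u)^[n] (candidates C p1 p2 u v) ∧
        v ∈ (ecStep M u)^[n] (candidates C p1 p2 u v) := by
  have he : ∀ k : ℕ, ¬ k % 2 = 1 ↔ Even k := fun k => by rw [← Nat.odd_iff, Nat.not_odd_iff_even]
  simp only [he, mem_iterate_ecStep]
  constructor
  · rintro ⟨D, hD, hDC, h1, h2⟩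
    obtain ⟨u, hu, hue, hum⟩ := exists_max_of_maxEven_nonempty h1
    obtain ⟨v, hv, hve, hvm⟩ := exists_max_of_maxEven_nonempty h2
    exact ⟨u, v, hue, hve, D, hD, fun s hs => ⟨hDC hs, hum s hs, hvm s hs⟩, hu, hv⟩
  · rintro ⟨u, v, hue, hve, D, hD, hDX, hu, hv⟩
    exact ⟨D, hD, fun s hs => (hDX hs).1,
      maxEven_nonempty_of_max hu hue fun t ht => (hDX ht).2.1,
      maxEven_nonempty_of_max hv hve fun t ht => (hDX ht).2.2⟩

end

/-! ### The decision procedure -/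

namespace Instance2U

open Tree2 WHILE

/-- The list of state indices. -/
def progStates (x : Tree2) : Tree2 := x.tl.hd.indices

def progEdge (x s t : Tree2) : Tree2 := (x.hd.nth s).nth t

def progS1 (x s : Tree2) : Tree2 := x.tl.hd.nth s

/-- The table of a set of states. -/
def progSet (x : Tree2) (g : Tree2 → Tree2) : Tree2 := (progStates x).map fun s => (g s).toBool

def progReach (x Z a : Tree2) : Tree2 :=
  Tree2.iterate (fun R => progSet x fun t => (Z.nth t).and ((t.eqLength a).or
    ((progStates x).any fun r => (R.nth r).and (progEdge x r t)))) nil (progStates x)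

/-- The clauses mirror `ecStep` one by one; closedness is a negated existential there because `any`
is the available quantifier. -/
def progEcStep (x u Z : Tree2) : Tree2 :=
  progSet x fun s => (Z.nth s).and ((((progS1 x s).and
    ((progStates x).any fun t => (progEdge x s t).and (Z.nth t))).or
    ((progS1 x s).not.and
      ((progStates x).any fun t => (progEdge x s t).and (Z.nth t).not).not)).and
    (((progReach x Z u).nth s).and ((progReach x Z s).nth u)))

def progCandidates (x u v : Tree2) : Tree2 :=
  progSet x fun s => (x.tl.tl.tl.hd.nth s).and
    (((x.tl.tl.tl.tl.hd.nth s).natLe (x.tl.tl.tl.tl.hd.nth u)).and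
      ((x.tl.tl.tl.tl.tl.hd.nth s).natLe (x.tl.tl.tl.tl.tl.hd.nth v)))

def progMaxEC (x u v : Tree2) : Tree2 :=
  Tree2.iterate (fun Z => progEcStep x u Z) (progCandidates x u v) (progStates x)

def prog (x : Tree2) : Tree2 :=
  (progStates x).any fun u => (progStates x).any fun v =>
    (x.tl.tl.tl.tl.hd.nth u).hd.not.and ((x.tl.tl.tl.tl.tl.hd.nth v).hd.not.and
      (((progMaxEC x u v).nth u).and ((progMaxEC x u v).nth v)))

/-! ### The procedure runs in polynomial time -/

section PolyTime

variable {X A B : Tree2 → Tree2}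

theorem polyFun_progStates (hX : PolyFun X) : PolyFun fun y => progStates (X y) :=
  hX.tl.hd.indices

theorem polyFun_progEdge (hX : PolyFun X) (hA : PolyFun A) (hB : PolyFun B) :
    PolyFun fun y => progEdge (X y) (A y) (B y) :=
  (hX.hd.nth hA).nth hB

theorem polyFun_progS1 (hX : PolyFun X) (hA : PolyFun A) :
    PolyFun fun y => progS1 (X y) (A y) :=
  hX.tl.hd.nth hA

theorem polyFun_progSet {g : Tree2 → Tree2 → Tree2} (hX : PolyFun X)
    (hg : PolyFun fun y => g y.hd y.tl) : PolyFun fun y => progSet (X y) fun s => g s y :=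
  .map (g := fun s y => (g s y).toBool) (polyFun_progStates hX) hg.toBool

/-- The bound does not depend on g, so iterating a table-valued function cannot enlarge the tables.
-/
theorem size_map_toBool_le (g : Tree2 → Tree2) (l : Tree2) :
    (l.map fun s => (g s).toBool).size ≤ 4 * l.size := by
  have key : ∀ t : Tree2, (∀ e ∈ t.toList, e.size ≤ 3) → t.size ≤ 4 * t.toList.length + 1 := by
    intro t
    induction t with
    | nil => simp [size]
    | cons e r _ ih =>
      intro h
      have h1 := h e (by simp [toList])
      have h2 := ih fun e' he' => h e' (by simp [toList, he'])
      simp only [size, toList, List.length_cons]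
      omega
  have key' : ∀ t : Tree2, t.toList.length + 1 ≤ t.size := by
    intro t
    induction t with
    | nil => simp [toList, size]
    | cons e r _ ih => simp only [size, toList, List.length_cons]; omega
  have h := key (l.map fun s => (g s).toBool) (by
    intro e he
    rw [toList_map, List.mem_map] at he
    obtain ⟨a, -, rfl⟩ := he
    cases g a <;> simp [Tree2.toBool, Tree2.cond, size])
  rw [toList_map, List.length_map] at h
  have := key' l
  omega

/-- Iterations of functions whose values are tables of sets of states. -/
theorem polyFun_iterate_progSet {h : Tree2 → Tree2} {g : Tree2 → Tree2 → Tree2 → Tree2}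
    (hX : PolyFun X) (hA : PolyFun A) (hh : PolyFun h)
    (hg : PolyFun fun y => g y.hd y.tl.hd y.tl.tl) :
    PolyFun fun y => Tree2.iterate (fun R => progSet (X y) fun t => g t R y) (A y) (h y) := by
  have ⟨b, hb, hbs, _⟩ := polyFun_progStates hX
  refine .iterate (g := fun R y => progSet (X y) fun t => g t R y) hA hh ?_
    ((PolyBdd.const 4).mul hb) fun a y => ?_
  · exact polyFun_progSet (g := fun t z => g t z.hd z.tl) (hX.comp PolyFun.self.tl) hg
  · exact (size_map_toBool_le _ _).trans (Nat.mul_le_mul_left _ (hbs y))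

theorem polyFun_progReach (hX : PolyFun X) (hA : PolyFun A) (hB : PolyFun B) :
    PolyFun fun y => progReach (X y) (A y) (B y) := by
  refine polyFun_iterate_progSet (g := fun t R y => ((A y).nth t).and ((t.eqLength (B y)).or
    ((progStates (X y)).any fun r => (R.nth r).and (progEdge (X y) r t)))) hX .nil
    (polyFun_progStates hX) ?_
  have h2 := PolyFun.self.tl.tl
  refine .and (.nth (hA.comp h2) PolyFun.self.hd)
    (.or (.eqLength PolyFun.self.hd (hB.comp h2)) ?_)
  refine .any (g := fun r y => (y.tl.hd.nth r).and (progEdge (X y.tl.tl) r y.hd))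
    (polyFun_progStates (hX.comp h2)) ?_
  exact .and (.nth PolyFun.self.tl.tl.hd PolyFun.self.hd)
    (polyFun_progEdge (hX.comp h2.tl) PolyFun.self.hd PolyFun.self.tl.hd)

theorem polyFun_progCandidates (hX : PolyFun X) (hA : PolyFun A) (hB : PolyFun B) :
    PolyFun fun y => progCandidates (X y) (A y) (B y) := by
  refine polyFun_progSet (g := fun s y => ((X y).tl.tl.tl.hd.nth s).and
    ((((X y).tl.tl.tl.tl.hd.nth s).natLe ((X y).tl.tl.tl.tl.hd.nth (A y))).and
      (((X y).tl.tl.tl.tl.tl.hd.nth s).natLe ((X y).tl.tl.tl.tl.tl.hd.nth (B y))))) hX ?_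
  have hX' := hX.comp PolyFun.self.tl
  have hA' := hA.comp PolyFun.self.tl
  have hB' := hB.comp PolyFun.self.tl
  have hs := PolyFun.self.hd
  exact .and (hX'.tl.tl.tl.hd.nth hs) (.and (.natLe (hX'.tl.tl.tl.tl.hd.nth hs)
    (hX'.tl.tl.tl.tl.hd.nth hA')) (.natLe (hX'.tl.tl.tl.tl.tl.hd.nth hs)
    (hX'.tl.tl.tl.tl.tl.hd.nth hB')))

theorem polyFun_progMaxEC (hX : PolyFun X) (hA : PolyFun A) (hB : PolyFun B) :
    PolyFun fun y => progMaxEC (X y) (A y) (B y) := by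
  refine polyFun_iterate_progSet (g := fun s Z y => (Z.nth s).and ((((progS1 (X y) s).and
    ((progStates (X y)).any fun t => (progEdge (X y) s t).and (Z.nth t))).or
    ((progS1 (X y) s).not.and
      ((progStates (X y)).any fun t => (progEdge (X y) s t).and (Z.nth t).not).not)).and
    (((progReach (X y) Z (A y)).nth s).and ((progReach (X y) Z s).nth (A y))))) hX
    (polyFun_progCandidates hX hA hB) (polyFun_progStates hX) ?_
  have hX' := hX.comp PolyFun.self.tl.tl
  have hA' := hA.comp PolyFun.self.tl.tl
  have hs := PolyFun.self.hd
  have hZ := PolyFun.self.tl.hd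
  have hX'' := hX.comp PolyFun.self.tl.tl.tl
  have hs' := PolyFun.self.tl.hd
  have hZ' := PolyFun.self.tl.tl.hd
  refine .and (hZ.nth hs) (.and (.or (.and (polyFun_progS1 hX' hs) ?_)
    (.and (polyFun_progS1 hX' hs).not (.not ?_)))
    (.and (.nth (polyFun_progReach hX' hZ hA') hs) (.nth (polyFun_progReach hX' hZ hs) hA')))
  · exact .any (g := fun t y => (progEdge (X y.tl.tl) y.hd t).and (y.tl.hd.nth t))
      (polyFun_progStates hX') (.and (polyFun_progEdge hX'' hs' hs) (hZ'.nth hs))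
  · exact .any (g := fun t y => (progEdge (X y.tl.tl) y.hd t).and (y.tl.hd.nth t).not)
      (polyFun_progStates hX') (.and (polyFun_progEdge hX'' hs' hs) (hZ'.nth hs).not)

theorem polyFun_prog : PolyFun prog := by
  have hx := PolyFun.self.tl.tl
  have hu := PolyFun.self.tl.hd
  have hv := PolyFun.self.hd
  refine .any (g := fun u x => (progStates x).any fun v =>
    (x.tl.tl.tl.tl.hd.nth u).hd.not.and ((x.tl.tl.tl.tl.tl.hd.nth v).hd.not.and
      (((progMaxEC x u v).nth u).and ((progMaxEC x u v).nth v)))) (polyFun_progStates .self) ?_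
  refine .any (g := fun v y => (y.tl.tl.tl.tl.tl.hd.nth y.hd).hd.not.and
    ((y.tl.tl.tl.tl.tl.tl.hd.nth v).hd.not.and (((progMaxEC y.tl y.hd v).nth y.hd).and
      ((progMaxEC y.tl y.hd v).nth v)))) (polyFun_progStates PolyFun.self.tl) ?_
  have hm := polyFun_progMaxEC hx hu hv
  exact .and (hx.tl.tl.tl.tl.hd.nth hu).hd.not (.and (hx.tl.tl.tl.tl.tl.hd.nth hv).hd.not
    ((hm.nth hu).and (hm.nth hv)))

end PolyTime

/-! ### The procedure decides the graph condition -/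

section Correctness

variable (I : Instance2U)

/-- A tree represents a state if it is a list of the corresponding length. -/
def IsState (t : Tree2) (i : Fin I.n) : Prop := t.toList.length = i

/-- A tree represents a set of states if looking up its entries decides membership. -/
def IsTable (Z : Tree2) (A : Set (Fin I.n)) : Prop :=
  ∀ t i, I.IsState t i → (Z.nth t ≠ nil ↔ i ∈ A)

variable {I}

theorem nth_encFun {n : ℕ} (f : Fin n → Tree2) {t : Tree2} {i : Fin n}
    (h : t.toList.length = i) : (encFun f).nth t = f i := by
  rw [nth_eq, encFun, toList_encList, h]
  simp

theorem encBool_decide_ne_nil {p : Prop} {_ : Decidable p} : encBool (decide p) ≠ nil ↔ p := by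
  by_cases h : p <;> simp [h, encBool]

theorem length_indices : (progStates I.encode).toList.map (fun e => e.toList.length)
    = List.range I.n := by
  rw [progStates, toList_indices]
  simp [encode, encList, hd_cons, tl_cons, encFun, toList_encList]

theorem length_progStates : (progStates I.encode).toList.length = I.n := by
  simpa using congrArg List.length (length_indices (I := I))

theorem any_progStates {g : Tree2 → Tree2} {P : Fin I.n → Prop}
    (h : ∀ t i, I.IsState t i → (g t ≠ nil ↔ P i)) :
    (progStates I.encode).any g ≠ nil ↔ ∃ i, P i := by
  rw [any_ne_nil]
  have hl := length_indices (I := I)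
  constructor
  · rintro ⟨e, he, hge⟩
    have hm : e.toList.length ∈ List.range I.n := by
      rw [← hl]; exact List.mem_map_of_mem he
    exact ⟨⟨_, List.mem_range.1 hm⟩, (h e ⟨_, List.mem_range.1 hm⟩ rfl).1 hge⟩
  · rintro ⟨i, hi⟩
    have hm : (i : ℕ) ∈ List.range I.n := List.mem_range.2 i.2
    rw [← hl] at hm
    obtain ⟨e, he, hei⟩ := List.mem_map.1 hm
    exact ⟨e, he, (h e i hei).2 hi⟩

theorem isTable_progSet {g : Tree2 → Tree2} {A : Set (Fin I.n)}
    (h : ∀ t i, I.IsState t i → (g t ≠ nil ↔ i ∈ A)) : I.IsTable (progSet I.encode g) A := by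
  intro t i hti
  have hlen := length_progStates (I := I)
  have hi : (i : ℕ) < (progStates I.encode).toList.length := by rw [hlen]; exact i.2
  -- The tree listed at position i need not be t, but it represents the same state. This is why the
  -- hypothesis covers all representations.
  have hst : I.IsState ((progStates I.encode).toList[(i : ℕ)]) i := by
    have h1 : ((progStates I.encode).toList.map (fun e => e.toList.length))[(i : ℕ)]'
        (by simpa using hi) = (List.range I.n)[(i : ℕ)]'(by simp) := by
      simp only [length_indices]
    simpa [IsState] using h1
  rw [nth_eq, progSet, toList_map, hti]
  rw [List.getD_eq_getElem _ _ (by simpa using hi), List.getElem_map, toBool_ne_nil]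
  exact h _ i hst

theorem isTable_nil : I.IsTable nil ∅ := by
  intro t i _
  simp [nth_eq, toList]

theorem isTable_iterate {F : Tree2 → Tree2} {f : Set (Fin I.n) → Set (Fin I.n)}
    (h : ∀ Z A, I.IsTable Z A → I.IsTable (F Z) (f A)) {Z : Tree2} {A : Set (Fin I.n)}
    (hZ : I.IsTable Z A) :
    I.IsTable (Tree2.iterate F Z (progStates I.encode)) (f^[I.n] A) := by
  rw [iterate_eq, length_progStates]
  have key : ∀ k, I.IsTable (F^[k] Z) (f^[k] A) := by
    intro k
    induction k with
    | zero => exact hZ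
    | succ k ih =>
      rw [Function.iterate_succ_apply', Function.iterate_succ_apply']
      exact h _ _ ih
  exact key I.n

theorem progEdge_ne_nil {s t : Tree2} {i j : Fin I.n} (hs : I.IsState s i) (ht : I.IsState t j) :
    progEdge I.encode s t ≠ nil ↔ I.M.E i j := by
  rw [progEdge, encode, encList, hd_cons, id, nth_encFun _ hs, nth_encFun _ ht]
  exact encBool_decide_ne_nil

theorem progS1_ne_nil {s : Tree2} {i : Fin I.n} (hs : I.IsState s i) :
    progS1 I.encode s ≠ nil ↔ i ∈ I.M.S1 := by
  rw [progS1, encode]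
  simp only [encList, hd_cons, tl_cons, id]
  rw [nth_encFun _ hs]
  exact encBool_decide_ne_nil

theorem eqLength_ne_nil_iff {s t : Tree2} {i j : Fin I.n} (hs : I.IsState s i)
    (ht : I.IsState t j) : s.eqLength t ≠ nil ↔ i = j := by
  rw [eqLength_ne_nil, hs, ht, Fin.ext_iff]

theorem isTable_progReach {Z a : Tree2} {A : Set (Fin I.n)} {i : Fin I.n} (hZ : I.IsTable Z A)
    (ha : I.IsState a i) :
    I.IsTable (progReach I.encode Z a) {j | ReachIn I.M.E A i j} := by
  have key : I.IsTable (progReach I.encode Z a) ((reachStep I.M.E A i)^[I.n] ∅) := by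
    refine isTable_iterate (fun R B hR => isTable_progSet fun t j hj => ?_) isTable_nil
    rw [and_ne_nil, or_ne_nil, hZ t j hj, eqLength_ne_nil_iff hj ha, any_progStates]
    · rfl
    · intro r k hk
      rw [and_ne_nil, hR r k hk, progEdge_ne_nil hk hj]
  intro t j hj
  rw [key t j hj, mem_iterate_reachStep]
  rfl

theorem isTable_progEcStep {Z u : Tree2} {A : Set (Fin I.n)} {i : Fin I.n} (hZ : I.IsTable Z A)
    (hu : I.IsState u i) : I.IsTable (progEcStep I.encode u Z) (ecStep I.M i A) := by
  refine isTable_progSet fun s j hs => ?_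
  simp only [and_ne_nil, or_ne_nil, not_ne_nil]
  rw [hZ s j hs, progS1_ne_nil hs, ← not_ne_iff (a := progS1 _ _), progS1_ne_nil hs,
    isTable_progReach hZ hu s j hs, isTable_progReach hZ hs u i hu, any_progStates
      (P := fun t => I.M.E j t ∧ t ∈ A), ← not_ne_iff (a := Tree2.any _ _), any_progStates
      (P := fun t => I.M.E j t ∧ t ∉ A)]
  · rfl
  · intro t k hk
    rw [and_ne_nil, not_ne_nil, progEdge_ne_nil hs hk, ← not_ne_iff, hZ t k hk]
  · intro t k hk
    rw [and_ne_nil, progEdge_ne_nil hs hk, hZ t k hk]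

theorem encode_C {s : Tree2} {i : Fin I.n} (hs : I.IsState s i) :
    I.encode.tl.tl.tl.hd.nth s ≠ nil ↔ i ∈ I.C := by
  rw [encode]
  simp only [encList, hd_cons, tl_cons, id]
  rw [nth_encFun _ hs]
  exact encBool_decide_ne_nil

theorem encode_p1 {s : Tree2} {i : Fin I.n} (hs : I.IsState s i) :
    I.encode.tl.tl.tl.tl.hd.nth s = encNat (I.p1 i) := by
  rw [encode]
  simp only [encList, hd_cons, tl_cons, id]
  rw [nth_encFun _ hs]

theorem encode_p2 {s : Tree2} {i : Fin I.n} (hs : I.IsState s i) :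
    I.encode.tl.tl.tl.tl.tl.hd.nth s = encNat (I.p2 i) := by
  rw [encode]
  simp only [encList, hd_cons, tl_cons, id]
  rw [nth_encFun _ hs]

theorem isTable_progCandidates {u v : Tree2} {i j : Fin I.n} (hu : I.IsState u i)
    (hv : I.IsState v j) :
    I.IsTable (progCandidates I.encode u v) (candidates I.C I.p1 I.p2 i j) := by
  refine isTable_progSet fun s k hs => ?_
  rw [and_ne_nil, and_ne_nil, encode_C hs, encode_p1 hs, encode_p1 hu, encode_p2 hs, encode_p2 hv,
    natLe_ne_nil, natLe_ne_nil]
  rfl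

theorem prog_encode_ne_nil : prog I.encode ≠ nil ↔ I.Holds := by
  rw [Holds, MDP.cond2U_iff, exists_isEC_maxEven_iff, prog]
  refine any_progStates fun u i hu => any_progStates fun v j hv => ?_
  have h : I.IsTable (progMaxEC I.encode u v)
      ((ecStep I.M i)^[I.n] (candidates I.C I.p1 I.p2 i j)) :=
    isTable_iterate (fun Z A hZ => isTable_progEcStep hZ hu) (isTable_progCandidates hu hv)
  rw [and_ne_nil, and_ne_nil, and_ne_nil, not_ne_nil, not_ne_nil, encode_p1 hu, encode_p2 hv,
    ← not_ne_iff (a := (encNat _).hd), hd_encNat_ne_nil,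
    ← not_ne_iff (a := (encNat (I.p2 j)).hd), hd_encNat_ne_nil, h u i hu, h v j hv]

end Correctness

end Instance2U

theorem lemma6 :
    WHILE.PolyTimeDecidable Instance2U.encode Instance2U.Holds ∧
    ∀ (S : Type*) [Fintype S] [MeasurableSpace S] [MeasurableSingletonClass S]
      (M : MDP S) (C : Finset S) (hC : M.IsEC C) (p1 p2 : S → ℕ),
      M.Cond2U C hC p1 p2 →
      ∃ lam : (M.restrict C hC).Strategy, lam.Memoryless ∧
        (∀ s, MDP.IsWitness lam s (fun x => p1 x.1) (fun x => p2 x.1)) ∧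
        ∃ D : Finset S, M.IsEC D ∧ D ⊆ C ∧
          (maxEven D p1).Nonempty ∧ (maxEven D p2).Nonempty ∧
          (∀ s, MDP.Pr lam s {π | π ∈ MDP.Out lam ∧ Subtype.val '' infStates π = (D : Set S)} = 1) ∧
          ∀ s, ∀ ε : ℝ, 0 < ε → ∃ n : ℕ,
            1 - ε ≤ (MDP.Pr lam s).real
              {π | π ∈ MDP.Out lam ∧ ∃ i, i ≤ n ∧ (π i : S) ∈ maxEven D p1} := by
  refine ⟨Instance2U.polyFun_prog.polyTimeDecidable fun I => Instance2U.prog_encode_ne_nil, ?_⟩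
  intro S _ _ _ M C hC p1 p2 h
  obtain ⟨D, hD, hDC, h1, h2⟩ := MDP.exists_isEC_of_cond2U h
  obtain ⟨lam, hm, hw, hinf, hvis⟩ := MDP.exists_memoryless_witness (hC := hC) hD hDC h1 h2
  exact ⟨lam, hm, hw, D, hD, hDC, h1, h2, hinf, hvis⟩
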